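/- Let $D\subseteq\mathbb R$ and let $u:D\to\mathbb R$ be an invertible utility function: $u$ is injective, its range $R=u(D)$ is open, and its inverse $x:R\to D$ is twice continuously differentiable. On a probability space consider a family of alternatives $i\in\mathcal I$; in alternative $i$ utility is a Brownian motion with drift, $$U_i(t)=U_i(0)+a_i t+b_i W_i(t),\qquad\text{i.e. } dU_i=a_i\,dt+b_i\,dW_i ,$$ where $a_i,b_i\in\mathbb R$, $W_i$ is a standard Brownian motion relative to a filtration $\mathcal F^i$, and $U_i(0)$ is $\mathcal F^i_0$-measurable. Put $X_i(t)=x(U_i(t))$ (the wealth process) and $\Delta u_i=u(X_i(t_0+\Delta t))-u(X_i(t_0))$ for $t_0\ge 0$, $\Delta t>0$. 1. As long as $U_i$ has not left $R$, the process $X_i$ lies in $D$, satisfies $u(X_i(t))=U_i(t)$, and is an adapted continuous process that satisfies the Itô stochastic differential equation $dX_i=a_x(X_i)\,dt+b_x(X_i)\,dW_i$, where, writing $x'$ and $x''$ for the derivatives of $x$, $$a_x(y)=a_i\,x'(u(y))+\tfrac12 b_i^2\,x''(u(y)),\qquad b_x(y)=b_i\,x'(u(y)).$$ Suppose now that almost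 surely no $U_i$ ever leaves $R$ (for instance, $R=\mathbb R$). Then: 2. For every $i$, $t_0\ge0$ and $\Delta t>0$, $\Delta u_i$ is integrable and $\langle\Delta u_i\rangle/\Delta t=a_i$; and for every $t_0$, almost surely $\lim_{\Delta t\to\infty}\Delta u_i/\Delta t=a_i$. So the rate of change of the expected change in utility equals the time-average growth rate. 3. Maximising expected utility change is the same as maximising time-average growth: for all $t_0\ge 0$, $\Delta t>0$ and every set $S\subseteq\mathcal I$ of alternatives, $i\in S$ maximises $\langle\Delta u_j\rangle$ over $j\in S$ if and only if it maximises the time-average growth rate over $j\in S$. 4. For all $i,j$, $t_0\ge0$ and $\Delta t>0$: if $\langle\Delta u_i\rangle>\langle\Delta u_j\rangle$, then the probability that, from $t_0$ to $t_0+T$, the utility gained per unit of time in alternative $i$ exceeds that in alternative $j$ tends to $1$ as $T\to\infty$. If moreover the $W_i$ are jointly Gaussian (for example all equal, or independent), then $\langle\Delta u_i\rangle>\langle\Delta u_j\rangle$ holds if and only if for every $\varepsilon\in(0,1)$ there is $T>0$ for which this probability is greater than $1-\varepsilon$. -/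

import Mathlib

open MeasureTheory ProbabilityTheory Filter Topology Set
open scoped NNReal ENNReal

namespace ErgodicUtility

noncomputable section

variable {Ω : Type*} [mΩ : MeasurableSpace Ω]

/-! ### Brownian motion relative to a filtration and the Itô integral -/

/-- `W` is a standard Brownian motion relative to the filtration `𝓕`: it is a Brownian motion,
it is adapted, and its increments after time `s` are independent of `𝓕 s`. -/
structure IsFilteredBrownian (𝓕 : Filtration ℝ≥0 mΩ) (W : ℝ≥0 → Ω → ℝ) (P : Measure Ω) : Prop where
  isBrownian : IsBrownianReal W P
  adapted : StronglyAdapted 𝓕 W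
  indep : ∀ s t : ℝ≥0, s ≤ t →
    Indep (MeasurableSpace.comap (fun ω ↦ W t ω - W s ω) inferInstance) (𝓕 s) P

/-- A step process `∑ i < n, coeff i · 1_{(time i, time (i + 1)]}` with nondecreasing
deterministic times and with `coeff i` measurable with respect to `𝓕 (time i)`. -/
structure StepProcess (𝓕 : Filtration ℝ≥0 mΩ) where
  n : ℕ
  time : ℕ → ℝ≥0
  mono : Monotone time
  coeff : ℕ → Ω → ℝ
  measurable_coeff : ∀ i, Measurable[𝓕 (time i)] (coeff i)

/-- The value of a step process at time `s`. -/
def StepProcess.value {𝓕 : Filtration ℝ≥0 mΩ} (H : StepProcess 𝓕) (s : ℝ≥0) (ω : Ω) : ℝ :=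
  ∑ i ∈ Finset.range H.n, (Ioc (H.time i) (H.time (i + 1))).indicator (fun _ ↦ H.coeff i ω) s

/-- The elementary stochastic integral `∫₀ᵗ H dW` of a step process. -/
def StepProcess.integral {𝓕 : Filtration ℝ≥0 mΩ} (H : StepProcess 𝓕) (W : ℝ≥0 → Ω → ℝ)
    (t : ℝ≥0) (ω : Ω) : ℝ :=
  ∑ i ∈ Finset.range H.n,
    H.coeff i ω * (W (min (H.time (i + 1)) t) ω - W (min (H.time i) t) ω)

/-- `I = ∫₀ᵗ H dW` in the sense of Itô, on the event `A` (`A = univ` is the usual Itô integral):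
there are step processes `Hₙ` such that, in probability on `A`, `∫₀ᵗ |Hₙ - H|² ds → 0` and
`∫₀ᵗ Hₙ dW → I`. -/
def IsItoIntegralOn (𝓕 : Filtration ℝ≥0 mΩ) (W : ℝ≥0 → Ω → ℝ) (P : Measure Ω) (A : Set Ω)
    (H : ℝ≥0 → Ω → ℝ) (t : ℝ≥0) (I : Ω → ℝ) : Prop :=
  ∃ Hn : ℕ → StepProcess 𝓕,
    (∀ ε : ℝ≥0∞, 0 < ε → Tendsto (fun n ↦ P {ω ∈ A | ε ≤ ∫⁻ s in Icc (0 : ℝ) t,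
      ENNReal.ofReal (((Hn n).value s.toNNReal ω - H s.toNNReal ω) ^ 2)}) atTop (𝓝 0)) ∧
    (∀ ε : ℝ, 0 < ε →
      Tendsto (fun n ↦ P {ω ∈ A | ε ≤ |(Hn n).integral W t ω - I ω|}) atTop (𝓝 0))

/-- The adapted process `X` satisfies `dX = α(X) dt + β(X) dW` during its lifetime;
`alive t` is the event that the lifetime has not ended by time `t`. -/
structure SolvesSDE (𝓕 : Filtration ℝ≥0 mΩ) (W : ℝ≥0 → Ω → ℝ) (P : Measure Ω)
    (alive : ℝ≥0 → Set Ω) (α β : ℝ → ℝ) (X : ℝ≥0 → Ω → ℝ) : Prop where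
  adapted : StronglyAdapted 𝓕 X
  continuous : ∀ᵐ ω ∂P, ∀ t, ω ∈ alive t → ContinuousOn (fun s ↦ X s ω) (Iic t)
  drift_integrable : ∀ᵐ ω ∂P, ∀ t : ℝ≥0, ω ∈ alive t →
    IntervalIntegrable (fun s : ℝ ↦ α (X s.toNNReal ω)) volume 0 t
  equation : ∃ I : ℝ≥0 → Ω → ℝ,
    (∀ t, IsItoIntegralOn 𝓕 W P (alive t) (fun s ω ↦ β (X s ω)) t (I t)) ∧
    ∀ᵐ ω ∂P, ∀ t : ℝ≥0, ω ∈ alive t →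
      X t ω = X 0 ω + (∫ s in (0 : ℝ)..t, α (X s.toNNReal ω)) + I t ω

/-! ### Utility and wealth -/

/-- `u` is an invertible utility function on the set `D` of wealth levels: it is injective on `D`,
its range `u '' D` is open, and its inverse is twice continuously differentiable there. -/
structure IsInvertibleUtility (u : ℝ → ℝ) (D : Set ℝ) : Prop where
  injOn : InjOn u D
  isOpen_range : IsOpen (u '' D)
  contDiffOn_inv : ContDiffOn ℝ 2 (Function.invFunOn u D) (u '' D)

/-- Brownian motion with drift, `dU = a dt + b dW`, started from `U₀`. -/
def driftedBM (a b : ℝ) (U₀ : Ω → ℝ) (W : ℝ≥0 → Ω → ℝ) (t : ℝ≥0) (ω : Ω) : ℝ :=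
  U₀ ω + a * t + b * W t ω

/-- The wealth process `x(U)`, where `x` is the inverse of `u : D → u '' D`. -/
def wealth (u : ℝ → ℝ) (D : Set ℝ) (U : ℝ≥0 → Ω → ℝ) (t : ℝ≥0) (ω : Ω) : ℝ :=
  Function.invFunOn u D (U t ω)

/-- The event that utility has stayed in the range of `u` up to and including time `t`. -/
def alive (u : ℝ → ℝ) (D : Set ℝ) (U : ℝ≥0 → Ω → ℝ) (t : ℝ≥0) : Set Ω :=
  {ω | ∀ s ≤ t, U s ω ∈ u '' D}

/-- The wealth drift `a_x = a x'(u) + (1/2) b² x''(u)`, as a function of wealth. -/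
def wealthDrift (u : ℝ → ℝ) (D : Set ℝ) (a b : ℝ) (x : ℝ) : ℝ :=
  a * deriv (Function.invFunOn u D) (u x) +
    1 / 2 * b ^ 2 * deriv (deriv (Function.invFunOn u D)) (u x)

/-- The wealth noise `b_x = b x'(u)`, as a function of wealth. -/
def wealthNoise (u : ℝ → ℝ) (D : Set ℝ) (b : ℝ) (x : ℝ) : ℝ :=
  b * deriv (Function.invFunOn u D) (u x)

/-- The change of utility `Δu = u(X(t₀ + Δt)) - u(X(t₀))`. -/
def utilityChange (u : ℝ → ℝ) (X : ℝ≥0 → Ω → ℝ) (t₀ Δt : ℝ≥0) (ω : Ω) : ℝ :=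
  u (X (t₀ + Δt) ω) - u (X t₀ ω)

/-- `r` is the time-average growth rate of `X`: almost surely `Δu / Δt → r` as `Δt → ∞`. -/
def IsTimeAverageGrowthRate (u : ℝ → ℝ) (X : ℝ≥0 → Ω → ℝ) (P : Measure Ω) (r : ℝ) : Prop :=
  ∀ t₀ : ℝ≥0, ∀ᵐ ω ∂P,
    Tendsto (fun Δt : ℝ≥0 ↦ utilityChange u X t₀ Δt ω / (Δt : ℝ)) atTop (𝓝 r)

/-- The event that `Δu / Δt` is larger for `X` than for `Y`. -/
def outgrows (u : ℝ → ℝ) (X Y : ℝ≥0 → Ω → ℝ) (t₀ Δt : ℝ≥0) : Set Ω :=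
  {ω | utilityChange u Y t₀ Δt ω / (Δt : ℝ) < utilityChange u X t₀ Δt ω / (Δt : ℝ)}

/-- The long-run decision criterion: for every `ε ∈ (0, 1)` there is `Δt > 0` such that `X` grows
faster than `Y` between `t₀` and `t₀ + Δt` with probability greater than `1 - ε`. -/
def LongRunPrefers (u : ℝ → ℝ) (X Y : ℝ≥0 → Ω → ℝ) (P : Measure Ω) (t₀ : ℝ≥0) : Prop :=
  ∀ ε : ℝ, 0 < ε → ε < 1 → ∃ Δt : ℝ≥0, 0 < Δt ∧ 1 - ε < P.real (outgrows u X Y t₀ Δt)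

end

end ErgodicUtility

namespace ErgodicUtility

/-! ### Pathwise Itô formula along dyadic partitions -/

/-! Itô's formula is obtained path by path. Almost surely, the squared increments of `W` along the
dyadic grids of `[0, t]` sum over each dyadic subinterval to its length in the limit
(`ae_tendsto_dyadic_quadratic_variation`). For a path with this property that stays in the range of
`u`, telescope `x(U t) - x(U 0)` over the grid and expand each term to second order. The quadratic
terms are weighted Riemann sums and converge to the second derivative integral
(`tendsto_sum_mul_dyadic`), so the first order sums must converge too (`tendsto_dyadic_ito_sum`).
Removing the drift leaves the elementary integrals of the step processes that sample `b x'(U)`.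
These step processes approximate `b x'(U)` uniformly on `[0, t]`, so the limit is the Itô integral
on the event `alive` (`isItoIntegralOn_of_ae_tendsto`). Since everything is asserted on that event
only, no stopping times enter.

If utility never leaves the range, `Δu = a Δt + b (W (t₀ + Δt) - W t₀)` almost surely. The noise has
mean zero, and divided by `Δt` it tends to zero by the strong law (`ae_tendsto_brownian_div_atTop`,
by time inversion); so both rates equal `a`, and all comparisons reduce to comparing drifts. For the
converse of the pairwise criterion, if `a i ≤ a j`, then `i` can outgrow `j` only where a centred
Gaussian variable is positive, an event of probability at most `1/2`. -/

lemma sum_range_mul_eq_sum_blocks {M : Type*} [AddCommMonoid M] (F : ℕ → M) (J N : ℕ) :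
    ∑ k ∈ Finset.range (J * N), F k
      = ∑ j ∈ Finset.range J, ∑ r ∈ Finset.range N, F (j * N + r) := by
  induction J with
  | zero => simp
  | succ J ih => rw [Finset.sum_range_succ, ← ih, Nat.succ_mul, Finset.sum_range_add]

/-- Second order Taylor expansion with Lagrange remainder, in either direction. -/
lemma exists_taylor_second_order {f : ℝ → ℝ} {R : Set ℝ} (hR : IsOpen R)
    (hf : ContDiffOn ℝ 2 f R) {p q : ℝ} (h : uIcc p q ⊆ R) :
    ∃ ξ ∈ uIcc p q,
      f q - f p = deriv f p * (q - p) + 1 / 2 * deriv (deriv f) ξ * (q - p) ^ 2 := by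
  rcases eq_or_ne p q with rfl | hpq
  · exact ⟨p, by simp, by simp⟩
  obtain ⟨ξ, hξ, hE⟩ := taylor_mean_remainder_lagrange_iteratedDeriv (n := 1) hpq
    (by exact_mod_cast hf.mono h)
  have hp : p ∈ R := h left_mem_uIcc
  have hd : DifferentiableAt ℝ f p :=
    ((hf.contDiffAt (hR.mem_nhds hp)).differentiableAt (by norm_num))
  have hu : UniqueDiffWithinAt ℝ (uIcc p q) p :=
    (uniqueDiffOn_Icc (by simpa using hpq.symm)) p left_mem_uIcc
  refine ⟨ξ, Ioo_subset_Icc_self hξ, ?_⟩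
  rw [taylorWithinEval_succ, taylor_within_zero_eval, iteratedDerivWithin_one,
    hd.derivWithin hu, iteratedDeriv_succ, iteratedDeriv_one] at hE
  norm_num at hE
  linarith

lemma dyadic_mem_Icc {T : ℝ} (hT : 0 ≤ T) {n k : ℕ} (hk : k ≤ 2 ^ n) :
    T * k / 2 ^ n ∈ Icc 0 T := by
  have h1 : (k : ℝ) ≤ 2 ^ n := by exact_mod_cast hk
  constructor
  · positivity
  · rw [div_le_iff₀ (by positivity)]
    gcongr

/-- If nonnegative weights on the dyadic grids of `[0, T]` converge on dyadic intervals to `c` times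
the length, then weighted sums of a continuous function, evaluated at arbitrary points of the grid
cells, converge to `c` times its integral. -/
lemma tendsto_sum_mul_dyadic {T c : ℝ} (hT : 0 ≤ T) {f : ℝ → ℝ} (hf : ContinuousOn f (Icc 0 T))
    {w : ℕ → ℕ → ℝ} (hw : ∀ n k, 0 ≤ w n k)
    (h : ∀ m j : ℕ, j ≤ 2 ^ m → Tendsto (fun n ↦ ∑ k ∈ Finset.range (j * 2 ^ (n - m)), w n k) atTop
      (𝓝 (c * (T * j / 2 ^ m))))
    {σ : ℕ → ℕ → ℝ}
    (hσ : ∀ n k : ℕ, k < 2 ^ n → σ n k ∈ Icc (T * k / 2 ^ n) (T * (k + 1 : ℕ) / 2 ^ n)) :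
    Tendsto (fun n ↦ ∑ k ∈ Finset.range (2 ^ n), f (σ n k) * w n k) atTop
      (𝓝 (c * ∫ s in (0 : ℝ)..T, f s)) := by
  have hsum : Tendsto (fun n ↦ ∑ k ∈ Finset.range (2 ^ n), w n k) atTop (𝓝 (c * T)) := by
    simpa using h 0 1 (by norm_num)
  have hcT : 0 ≤ c * T := ge_of_tendsto' hsum fun n ↦ Finset.sum_nonneg fun k _ ↦ hw n k
  have hcT' : 0 ≤ |c| * T := by positivity
  rw [Metric.tendsto_nhds]
  intro η hη
  -- Three errors are added: tags moved to the left end of their block, `ε (c T + 1)`; block weights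
  -- against their limits, `ε`; the Riemann sum against the integral, `|c| ε T`. The total stays
  -- below `η`.
  set ε := η / (c * T + |c| * T + 3) with hε
  have hεpos : 0 < ε := by positivity
  obtain ⟨δ, hδ, hfδ⟩ := Metric.uniformContinuousOn_iff_le.1
    (isCompact_Icc.uniformContinuousOn_of_continuous hf) ε hεpos
  obtain ⟨m, hm⟩ : ∃ m : ℕ, T / 2 ^ m ≤ δ := by
    have : Tendsto (fun m : ℕ ↦ T / 2 ^ m) atTop (𝓝 0) :=
      tendsto_const_nhds.div_atTop (tendsto_pow_atTop_atTop_of_one_lt (by norm_num))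
    exact (this.eventually (ge_mem_nhds hδ)).exists
  -- values of `f` in the `j`-th block of level `m`
  have hblock : ∀ j : ℕ, j < 2 ^ m → ∀ s ∈ Icc (T * j / 2 ^ m) (T * (j + 1 : ℕ) / 2 ^ m),
      |f s - f (T * j / 2 ^ m)| ≤ ε := by
    intro j hj s hs
    have h0 := dyadic_mem_Icc hT (n := m) hj.le
    have h1 := dyadic_mem_Icc hT (n := m) (k := j + 1) hj
    refine hfδ s ⟨h0.1.trans hs.1, hs.2.trans h1.2⟩ _ h0 ?_
    rw [Real.dist_eq, abs_of_nonneg (by linarith [hs.1])]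
    have : T * (j + 1 : ℕ) / 2 ^ m = T * j / 2 ^ m + T / 2 ^ m := by push_cast; ring
    linarith [hs.2]
  -- block sums of the weights
  have hB : ∀ j < 2 ^ m, Tendsto (fun n ↦ ∑ r ∈ Finset.range (2 ^ (n - m)),
      w n (j * 2 ^ (n - m) + r)) atTop (𝓝 (c * (T / 2 ^ m))) := by
    intro j hj
    have := (h m (j + 1) hj).sub (h m j hj.le)
    convert this using 2
    · rw [Nat.succ_mul, Finset.sum_range_add]; ring
    · push_cast; ring
  have hFB : Tendsto (fun n ↦ ∑ j ∈ Finset.range (2 ^ m), f (T * j / 2 ^ m) *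
      ∑ r ∈ Finset.range (2 ^ (n - m)), w n (j * 2 ^ (n - m) + r)) atTop
      (𝓝 (∑ j ∈ Finset.range (2 ^ m), f (T * j / 2 ^ m) * (c * (T / 2 ^ m)))) :=
    tendsto_finsetSum _ fun j hj ↦ (hB j (Finset.mem_range.1 hj)).const_mul _
  -- the integral against its left Riemann sum
  have h_int : |(∫ s in (0 : ℝ)..T, f s) - ∑ j ∈ Finset.range (2 ^ m), f (T * j / 2 ^ m) * (T / 2 ^ m)|
      ≤ ε * T := by
    have hii : ∀ j : ℕ, j < 2 ^ m → IntervalIntegrable f volume (T * j / 2 ^ m)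
        (T * (j + 1 : ℕ) / 2 ^ m) := by
      intro j hj
      have h0 := dyadic_mem_Icc hT (n := m) hj.le
      have h1 := dyadic_mem_Icc hT (n := m) (k := j + 1) hj
      exact (hf.mono (uIcc_subset_Icc h0 h1)).intervalIntegrable
    have hadj := intervalIntegral.sum_integral_adjacent_intervals (a := fun j : ℕ ↦ T * j / 2 ^ m)
      (f := f) (μ := volume) (n := 2 ^ m) hii
    have e1 : T * ((2 ^ m : ℕ) : ℝ) / 2 ^ m = T := by push_cast; field_simp
    simp only [Nat.cast_zero, mul_zero, zero_div, e1] at hadj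
    rw [← hadj, ← Finset.sum_sub_distrib]
    calc _ ≤ ∑ j ∈ Finset.range (2 ^ m), |(∫ s in (T * j / 2 ^ m)..(T * (j + 1 : ℕ) / 2 ^ m), f s)
            - f (T * j / 2 ^ m) * (T / 2 ^ m)| := Finset.abs_sum_le_sum_abs _ _
      _ ≤ ∑ j ∈ Finset.range (2 ^ m), ε * (T / 2 ^ m) := by
          refine Finset.sum_le_sum fun j hj ↦ ?_
          have hj := Finset.mem_range.1 hj
          have e2 : T * (j + 1 : ℕ) / 2 ^ m - T * j / 2 ^ m = T / 2 ^ m := by push_cast; ring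
          have hle : T * j / 2 ^ m ≤ T * (j + 1 : ℕ) / 2 ^ m := by
            have : 0 ≤ T / 2 ^ m := by positivity
            linarith
          have e3 : f (T * j / 2 ^ m) * (T / 2 ^ m)
              = ∫ s in (T * j / 2 ^ m)..(T * (j + 1 : ℕ) / 2 ^ m), f (T * j / 2 ^ m) := by
            rw [intervalIntegral.integral_const, e2, smul_eq_mul, mul_comm]
          rw [e3, ← intervalIntegral.integral_sub (hii j hj) intervalIntegrable_const]
          have := intervalIntegral.norm_integral_le_of_norm_le_const
            (a := T * j / 2 ^ m) (b := T * (j + 1 : ℕ) / 2 ^ m) (C := ε)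
            (f := fun s ↦ f s - f (T * j / 2 ^ m)) (fun s hs ↦ by
              rw [uIoc_of_le hle] at hs
              exact hblock j hj s (Ioc_subset_Icc_self hs))
          rwa [e2, abs_of_nonneg (by positivity : 0 ≤ T / 2 ^ m), Real.norm_eq_abs] at this
      _ = ε * T := by
          rw [Finset.sum_const, Finset.card_range, nsmul_eq_mul]; push_cast; field_simp
  filter_upwards [eventually_ge_atTop m, hsum.eventually (gt_mem_nhds (lt_add_one (c * T))),
    (Metric.tendsto_nhds.1 hFB) ε hεpos] with n hn h1 h2
  have hpow : 2 ^ m * 2 ^ (n - m) = 2 ^ n := by rw [← pow_add, Nat.add_sub_cancel' hn]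
  have hpow' : (2 : ℝ) ^ m * 2 ^ (n - m) = 2 ^ n := by exact_mod_cast hpow
  have hmain : |∑ k ∈ Finset.range (2 ^ n), f (σ n k) * w n k
      - ∑ j ∈ Finset.range (2 ^ m), f (T * j / 2 ^ m) *
      ∑ r ∈ Finset.range (2 ^ (n - m)), w n (j * 2 ^ (n - m) + r)|
      ≤ ε * ∑ k ∈ Finset.range (2 ^ n), w n k := by
    rw [← hpow, sum_range_mul_eq_sum_blocks, sum_range_mul_eq_sum_blocks, ← Finset.sum_sub_distrib,
      Finset.mul_sum]
    refine (Finset.abs_sum_le_sum_abs _ _).trans (Finset.sum_le_sum fun j hj ↦ ?_)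
    rw [Finset.mul_sum, Finset.mul_sum, ← Finset.sum_sub_distrib]
    refine (Finset.abs_sum_le_sum_abs _ _).trans (Finset.sum_le_sum fun r hr ↦ ?_)
    have hj := Finset.mem_range.1 hj
    have hr := Finset.mem_range.1 hr
    rw [← sub_mul, abs_mul, abs_of_nonneg (hw _ _)]
    refine mul_le_mul_of_nonneg_right (hblock j hj _ ?_) (hw _ _)
    have hk : j * 2 ^ (n - m) + r + 1 ≤ (j + 1) * 2 ^ (n - m) := by rw [Nat.succ_mul]; omega
    have hk' : j * 2 ^ (n - m) + r < 2 ^ n := by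
      rw [← hpow]
      exact lt_of_lt_of_le (Nat.lt_of_succ_le hk) (Nat.mul_le_mul_right _ hj)
    have hs := hσ n _ hk'
    constructor
    · refine le_trans ?_ hs.1
      rw [← hpow', div_le_div_iff₀ (by positivity) (by positivity)]
      push_cast
      have : 0 ≤ T * r * 2 ^ m := by positivity
      nlinarith
    · refine hs.2.trans ?_
      rw [← hpow', div_le_div_iff₀ (by positivity) (by positivity)]
      have hk2 : ((j * 2 ^ (n - m) + r + 1 : ℕ) : ℝ) ≤ (j + 1 : ℕ) * 2 ^ (n - m) := by
        exact_mod_cast hk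
      calc T * ((j * 2 ^ (n - m) + r + 1 : ℕ) : ℝ) * 2 ^ m
          ≤ T * ((j + 1 : ℕ) * 2 ^ (n - m)) * 2 ^ m := by gcongr
        _ = _ := by ring
  have hfac : ∑ j ∈ Finset.range (2 ^ m), f (T * j / 2 ^ m) * (c * (T / 2 ^ m))
      = c * ∑ j ∈ Finset.range (2 ^ m), f (T * j / 2 ^ m) * (T / 2 ^ m) := by
    rw [Finset.mul_sum]; exact Finset.sum_congr rfl fun _ _ ↦ by ring
  rw [hfac] at h2
  have h3 : |c * (∑ j ∈ Finset.range (2 ^ m), f (T * j / 2 ^ m) * (T / 2 ^ m))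
      - c * ∫ s in (0 : ℝ)..T, f s| ≤ |c| * (ε * T) := by
    rw [← mul_sub, abs_mul, abs_sub_comm]
    exact mul_le_mul_of_nonneg_left h_int (abs_nonneg _)
  have h4 := hmain.trans (mul_le_mul_of_nonneg_left h1.le hεpos.le)
  rw [Real.dist_eq] at h2 ⊢
  have hη' : η = ε * (c * T + |c| * T + 3) := by rw [hε, div_mul_cancel₀ _ (by positivity)]
  calc _ ≤ _ := (abs_sub_le _ _ _).trans (add_le_add h4 ((abs_sub_le _ _ _).trans
          (add_le_add h2.le h3)))
    _ < η := by rw [hη']; nlinarith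

/-- Left Riemann sums on dyadic grids. -/
lemma tendsto_dyadic_riemann_sum {T : ℝ} (hT : 0 ≤ T) {f : ℝ → ℝ} (hf : ContinuousOn f (Icc 0 T)) :
    Tendsto (fun n : ℕ ↦ ∑ k ∈ Finset.range (2 ^ n), f (T * k / 2 ^ n) * (T / 2 ^ n)) atTop
      (𝓝 (∫ s in (0 : ℝ)..T, f s)) := by
  have := tendsto_sum_mul_dyadic (c := 1) hT hf (w := fun n _ ↦ T / 2 ^ n)
    (fun n k ↦ by positivity) (fun m j _ ↦ ?_) (σ := fun n k ↦ T * k / 2 ^ n) (fun n k _ ↦ ?_)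
  · simpa using this
  · refine tendsto_const_nhds.congr' ?_
    filter_upwards [eventually_ge_atTop m] with n hn
    have hpow : (2 : ℝ) ^ m * 2 ^ (n - m) = 2 ^ n := by rw [← pow_add, Nat.add_sub_cancel' hn]
    rw [Finset.sum_const, Finset.card_range, nsmul_eq_mul, ← hpow]
    push_cast
    field_simp
  · refine ⟨le_rfl, ?_⟩
    gcongr
    simp

/-- **Itô's formula** for a single path with quadratic variation `c t` along the dyadic grids. -/
lemma tendsto_dyadic_ito_sum {T c : ℝ} (hT : 0 ≤ T) {U : ℝ → ℝ} (hU : ContinuousOn U (Icc 0 T))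
    {R : Set ℝ} (hR : IsOpen R) (hUR : ∀ s ∈ Icc 0 T, U s ∈ R) {x : ℝ → ℝ}
    (hx : ContDiffOn ℝ 2 x R)
    (hqv : ∀ m j : ℕ, j ≤ 2 ^ m → Tendsto (fun n ↦ ∑ k ∈ Finset.range (j * 2 ^ (n - m)),
      (U (T * (k + 1 : ℕ) / 2 ^ n) - U (T * k / 2 ^ n)) ^ 2) atTop (𝓝 (c * (T * j / 2 ^ m)))) :
    Tendsto (fun n ↦ ∑ k ∈ Finset.range (2 ^ n), deriv x (U (T * k / 2 ^ n)) *
      (U (T * (k + 1 : ℕ) / 2 ^ n) - U (T * k / 2 ^ n))) atTop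
      (𝓝 (x (U T) - x (U 0) - 1 / 2 * c * ∫ s in (0 : ℝ)..T, deriv (deriv x) (U s))) := by
  have hle : ∀ n k : ℕ, T * k / 2 ^ n ≤ T * (k + 1 : ℕ) / 2 ^ n := fun n k ↦ by gcongr; simp
  -- The condition `k < 2 ^ n` sits inside the existential so that `choose` yields a total tag
  -- function; off the grid the tag is a dummy.
  have hex : ∀ n k : ℕ, ∃ s, k < 2 ^ n → s ∈ Icc (T * k / 2 ^ n) (T * (k + 1 : ℕ) / 2 ^ n) ∧
      x (U (T * (k + 1 : ℕ) / 2 ^ n)) - x (U (T * k / 2 ^ n)) = deriv x (U (T * k / 2 ^ n)) *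
      (U (T * (k + 1 : ℕ) / 2 ^ n) - U (T * k / 2 ^ n)) + 1 / 2 * deriv (deriv x) (U s) *
      (U (T * (k + 1 : ℕ) / 2 ^ n) - U (T * k / 2 ^ n)) ^ 2 := by
    intro n k
    by_cases hk : k < 2 ^ n
    swap
    · exact ⟨0, fun h ↦ absurd h hk⟩
    have hsub : Icc (T * k / 2 ^ n) (T * (k + 1 : ℕ) / 2 ^ n) ⊆ Icc 0 T :=
      Icc_subset_Icc (dyadic_mem_Icc hT hk.le).1 (dyadic_mem_Icc hT (k := k + 1) hk).2
    -- By the intermediate value theorem the path covers the segment between its two endpoint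
    -- values. So the segment lies in `R` although `R` need not be convex, and the Lagrange point
    -- has the form `U s` with `s` in the same cell.
    have hivt : uIcc (U (T * k / 2 ^ n)) (U (T * (k + 1 : ℕ) / 2 ^ n))
        ⊆ U '' Icc (T * k / 2 ^ n) (T * (k + 1 : ℕ) / 2 ^ n) := by
      rw [← uIcc_of_le (hle n k)]
      refine intermediate_value_uIcc ?_
      rw [uIcc_of_le (hle n k)]
      exact hU.mono hsub
    obtain ⟨ξ, hξ, hE⟩ := exists_taylor_second_order hR hx (p := U (T * k / 2 ^ n))
      (q := U (T * (k + 1 : ℕ) / 2 ^ n)) (hivt.trans (by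
        rintro _ ⟨s, hs, rfl⟩; exact hUR s (hsub hs)))
    obtain ⟨s, hs, rfl⟩ := hivt hξ
    exact ⟨s, fun _ ↦ ⟨hs, hE⟩⟩
  choose σ hσ using hex
  have hx2 : ContinuousOn (fun s ↦ deriv (deriv x) (U s)) (Icc 0 T) := by
    have h1 : ContDiffOn ℝ 1 (deriv x) R := hx.deriv_of_isOpen hR (by norm_num)
    exact (h1.continuousOn_deriv_of_isOpen hR (by norm_num)).comp hU hUR
  have hlim := tendsto_sum_mul_dyadic hT hx2 (fun n k ↦ sq_nonneg
    (U (T * (k + 1 : ℕ) / 2 ^ n) - U (T * k / 2 ^ n))) hqv (σ := σ) (fun n k hk ↦ (hσ n k hk).1)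
  have hlim' := (tendsto_const_nhds (x := x (U T) - x (U 0))).sub (hlim.const_mul (1 / 2))
  rw [← mul_assoc] at hlim'
  refine hlim'.congr fun n ↦ ?_
  have htel := Finset.sum_range_sub (fun k : ℕ ↦ x (U (T * k / 2 ^ n))) (2 ^ n)
  have e1 : T * ((2 ^ n : ℕ) : ℝ) / 2 ^ n = T := by push_cast; field_simp
  simp only [Nat.cast_zero, mul_zero, zero_div, e1] at htel
  rw [← htel, Finset.mul_sum, ← Finset.sum_sub_distrib]
  refine Finset.sum_congr rfl fun k hk ↦ ?_
  rw [(hσ n k (Finset.mem_range.1 hk)).2]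
  ring

end ErgodicUtility

namespace ErgodicUtility

/-! ### Quadratic variation of Brownian motion -/

variable {Ω : Type*} [mΩ : MeasurableSpace Ω] {P : Measure Ω}

/-- The series of squared deviations has expectation equal to the sum of the variances, hence is
finite almost surely, and its terms tend to zero. -/
lemma ae_tendsto_sub_integral_of_summable_variance [IsFiniteMeasure P] {f : ℕ → Ω → ℝ}
    (hf : ∀ n, MemLp (f n) 2 P) (hs : Summable fun n ↦ Var[f n; P]) :
    ∀ᵐ ω ∂P, Tendsto (fun n ↦ f n ω - P[f n]) atTop (𝓝 0) := by
  have hm : ∀ n, AEMeasurable (fun ω ↦ ‖f n ω - P[f n]‖ₑ ^ 2) P := fun n ↦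
    ((hf n).aemeasurable.sub_const _).enorm.pow_const 2
  have hfin : ∫⁻ ω, ∑' n, ‖f n ω - P[f n]‖ₑ ^ 2 ∂P ≠ ∞ := by
    rw [lintegral_tsum hm]
    have : ∀ n, ∫⁻ ω, ‖f n ω - P[f n]‖ₑ ^ 2 ∂P = ENNReal.ofReal Var[f n; P] := fun n ↦ by
      rw [(hf n).ofReal_variance_eq]; rfl
    simp_rw [this]
    exact hs.tsum_ofReal_ne_top
  filter_upwards [ae_lt_top' (AEMeasurable.tsum hm) hfin] with ω hω
  have h0 := ENNReal.tendsto_atTop_zero_of_tsum_ne_top hω.ne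
  have h1 : Tendsto (fun n ↦ (f n ω - P[f n]) ^ 2) atTop (𝓝 0) := by
    have := (ENNReal.tendsto_toReal ENNReal.zero_ne_top).comp h0
    simpa [Function.comp_def] using this
  have h2 := (Real.continuous_sqrt.tendsto 0).comp h1
  rw [Real.sqrt_zero] at h2
  rw [tendsto_zero_iff_abs_tendsto_zero]
  simpa [Function.comp_def, Real.sqrt_sq_eq_abs] using h2

/-- By scaling, only the order `v ^ 2` matters below; the value of the fourth moment is never
needed. -/
lemma variance_sq_gaussianReal (v : ℝ≥0) :
    Var[fun x ↦ x ^ 2; gaussianReal 0 v] = (v : ℝ) ^ 2 * Var[fun x ↦ x ^ 2; gaussianReal 0 1] := by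
  have h : gaussianReal 0 v = (gaussianReal 0 1).map (√(v : ℝ) * ·) := by
    rw [gaussianReal_map_const_mul]
    congr 1
    · simp
    · ext; simp
  rw [h, variance_map (by fun_prop) (by fun_prop), ← variance_const_mul]
  congr 1
  ext x
  simp [mul_pow]

lemma sq_increment_memLp {W : ℝ≥0 → Ω → ℝ} (hW : IsPreBrownianReal W P) (s t : ℝ≥0) :
    MemLp (fun ω ↦ (W s ω - W t ω) ^ 2) 2 P := by
  have hl := hW.hasLaw_sub s t
  have h4 : MemLp (W s - W t) 4 P := by
    have := memLp_id_gaussianReal' (μ := 0) (v := nndist s.1 t.1) 4 (by simp)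
    rw [← hl.map_eq] at this
    exact this.comp_of_map hl.aemeasurable
  have : (fun ω ↦ (W s ω - W t ω) ^ 2) = (W s - W t) * (W s - W t) := by
    ext ω; simp [pow_two]
  rw [this]
  have : ENNReal.HolderTriple 4 4 2 := ⟨by
    rw [← ENNReal.toReal_eq_toReal_iff' (by simp) (by simp), ENNReal.toReal_add (by simp) (by simp)]
    simp; norm_num⟩
  exact h4.mul h4

lemma integral_sq_increment {W : ℝ≥0 → Ω → ℝ} (hW : IsPreBrownianReal W P) (s t : ℝ≥0) :
    ∫ ω, (W s ω - W t ω) ^ 2 ∂P = |(s : ℝ) - t| := by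
  have := hW.isGaussianProcess.isProbabilityMeasure
  have hl := hW.hasLaw_sub s t
  have h1 := hl.variance_eq
  rw [variance_id_gaussianReal, variance_eq_sub hl.hasGaussianLaw.memLp_two, hl.integral_eq,
    integral_id_gaussianReal] at h1
  simpa [NNReal.nndist_eq, ← Real.dist_eq] using h1

lemma variance_sq_increment {W : ℝ≥0 → Ω → ℝ} (hW : IsPreBrownianReal W P) (s t : ℝ≥0) :
    Var[fun ω ↦ (W s ω - W t ω) ^ 2; P]
      = ((s : ℝ) - t) ^ 2 * Var[fun x ↦ x ^ 2; gaussianReal 0 1] := by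
  have hl := hW.hasLaw_sub s t
  have : (fun ω ↦ (W s ω - W t ω) ^ 2) = (fun x : ℝ ↦ x ^ 2) ∘ (W s - W t) := rfl
  rw [this, ← variance_map (by fun_prop) hl.aemeasurable, hl.map_eq, variance_sq_gaussianReal]
  congr 1
  simp [Real.dist_eq]

/-- Along the dyadic grids of `[0, t]`, the quadratic variation of Brownian motion over a dyadic
interval converges almost surely to its length. -/
lemma ae_tendsto_dyadic_quadratic_variation {W : ℝ≥0 → Ω → ℝ} (hW : IsPreBrownianReal W P)
    (t : ℝ≥0) (m j : ℕ) :
    ∀ᵐ ω ∂P, Tendsto (fun n ↦ ∑ k ∈ Finset.range (j * 2 ^ (n - m)),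
      (W (t * (k + 1 : ℕ) / 2 ^ n) ω - W (t * k / 2 ^ n) ω) ^ 2) atTop
      (𝓝 ((t : ℝ) * j / 2 ^ m)) := by
  have := hW.isGaussianProcess.isProbabilityMeasure
  set C := Var[fun x : ℝ ↦ x ^ 2; gaussianReal 0 1] with hC
  have hC0 : 0 ≤ C := variance_nonneg _ _
  set f : ℕ → Ω → ℝ := fun n ↦ ∑ k ∈ Finset.range (j * 2 ^ (n - m)),
      fun ω ↦ (W (t * (k + 1 : ℕ) / 2 ^ n) ω - W (t * k / 2 ^ n) ω) ^ 2 with hf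
  have hmem : ∀ n, MemLp (f n) 2 P := fun n ↦
    memLp_finsetSum' _ fun k _ ↦ sq_increment_memLp hW _ _
  have hlen : ∀ n k : ℕ, ((t * (k + 1 : ℕ) / 2 ^ n : ℝ≥0) : ℝ) - ((t * k / 2 ^ n : ℝ≥0) : ℝ)
      = t / 2 ^ n := fun n k ↦ by push_cast; ring
  have hvar : ∀ n, Var[f n; P] = (j * 2 ^ (n - m) : ℕ) * ((t / 2 ^ n) ^ 2 * C) := by
    intro n
    have hmono : Monotone fun k : ℕ ↦ t * k / 2 ^ n := fun k l hkl ↦ by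
      dsimp only; gcongr
    have hind := (hW.hasIndepIncrements.nat hmono).comp (fun _ (x : ℝ) ↦ x ^ 2)
      (fun _ ↦ by fun_prop)
    rw [hf, IndepFun.variance_sum (fun k _ ↦ sq_increment_memLp hW _ _)
      (fun k _ l _ hkl ↦ hind.indepFun hkl)]
    simp_rw [variance_sq_increment hW, hlen, Finset.sum_const, Finset.card_range, nsmul_eq_mul]
    rfl
  have hsum : Summable fun n ↦ Var[f n; P] := by
    refine Summable.of_nonneg_of_le (fun n ↦ variance_nonneg _ _) (fun n ↦ ?_)
      ((summable_geometric_two).mul_left (j * t ^ 2 * C))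
    rw [hvar]
    -- With truncated subtraction this holds also for `n < m`, so the variance is of order `2⁻ⁿ` for
    -- every `n`.
    have h2 : (2 : ℝ) ^ (n - m) ≤ 2 ^ n := pow_le_pow_right₀ (by norm_num) (Nat.sub_le _ _)
    push_cast
    calc (j : ℝ) * 2 ^ (n - m) * ((t / 2 ^ n) ^ 2 * C) ≤ j * 2 ^ n * ((t / 2 ^ n) ^ 2 * C) := by
          gcongr
      _ = j * t ^ 2 * C * (1 / 2) ^ n := by
          rw [one_div, inv_pow]; field_simp
  have hmean : ∀ n, m ≤ n → P[f n] = (t : ℝ) * j / 2 ^ m := by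
    intro n hn
    have hpow : (2 : ℝ) ^ m * 2 ^ (n - m) = 2 ^ n := by rw [← pow_add, Nat.add_sub_cancel' hn]
    have e : P[f n] = ∫ ω, ∑ k ∈ Finset.range (j * 2 ^ (n - m)),
      (W (t * (k + 1 : ℕ) / 2 ^ n) ω - W (t * k / 2 ^ n) ω) ^ 2 ∂P := by simp [hf]
    rw [e, integral_finsetSum _ fun k _ ↦ (sq_increment_memLp hW _ _).integrable (by norm_num)]
    simp_rw [integral_sq_increment hW, hlen]
    rw [abs_of_nonneg (by positivity), Finset.sum_const, Finset.card_range, nsmul_eq_mul, ← hpow]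
    push_cast
    field_simp
  filter_upwards [ae_tendsto_sub_integral_of_summable_variance hmem hsum] with ω hω
  have := hω.add_const ((t : ℝ) * j / 2 ^ m)
  rw [zero_add] at this
  refine this.congr' ?_
  filter_upwards [eventually_ge_atTop m] with n hn
  rw [hmean n hn]
  simp [hf]

/-- Almost sure convergence on a possibly non-measurable event `A` implies convergence in
probability on `A`, provided the functions agree on `A` with measurable ones. -/
lemma tendsto_measure_of_ae_tendsto_zero_on [IsFiniteMeasure P] {A : Set Ω} {f g : ℕ → Ω → ℝ≥0∞}
    (hg : ∀ n, Measurable (g n)) (hfg : ∀ᵐ ω ∂P, ω ∈ A → ∀ n, f n ω = g n ω)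
    (h : ∀ᵐ ω ∂P, ω ∈ A → Tendsto (fun n ↦ f n ω) atTop (𝓝 0)) {ε : ℝ≥0∞} (hε : 0 < ε) :
    Tendsto (fun n ↦ P {ω ∈ A | ε ≤ f n ω}) atTop (𝓝 0) := by
  -- `A` may be non-measurable, so the bad events are enlarged to measurable ones defined by `g`
  -- alone. Intersecting with the convergence set of `g` makes their indicators tend to zero
  -- everywhere.
  have hC : MeasurableSet {ω | Tendsto (fun n ↦ g n ω) atTop (𝓝 0)} :=
    measurableSet_tendsto _ hg
  have hS : ∀ n, MeasurableSet ({ω | Tendsto (fun n ↦ g n ω) atTop (𝓝 0)} ∩ {ω | ε ≤ g n ω}) :=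
    fun n ↦ hC.inter (measurableSet_le measurable_const (hg n))
  have hlim : Tendsto (fun n ↦ P ({ω | Tendsto (fun n ↦ g n ω) atTop (𝓝 0)} ∩ {ω | ε ≤ g n ω}))
      atTop (𝓝 (P ∅)) := by
    refine tendsto_measure_of_ae_tendsto_indicator_of_isFiniteMeasure _ MeasurableSet.empty hS
      (ae_of_all _ fun ω ↦ ?_)
    by_cases hω : Tendsto (fun n ↦ g n ω) atTop (𝓝 0)
    · filter_upwards [hω.eventually (gt_mem_nhds hε)] with n hn
      simp [hn]
    · simp [hω]
  rw [measure_empty] at hlim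
  refine tendsto_of_tendsto_of_tendsto_of_le_of_le tendsto_const_nhds hlim (fun _ ↦ zero_le)
    fun n ↦ measure_mono_ae ?_
  filter_upwards [hfg, h] with ω h1 h2 h3
  refine ⟨?_, ?_⟩
  · simpa [h1 h3.1] using h2 h3.1
  · simpa [h1 h3.1] using h3.2

end ErgodicUtility

namespace ErgodicUtility

/-! ### The strong law of large numbers for Brownian motion -/

variable {Ω : Type*} [mΩ : MeasurableSpace Ω] {P : Measure Ω}

/-- A pre-Brownian motion with continuous paths on `(0, ∞)` tends to `0` at `0`, provided some
Brownian motion exists on the same space. -/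
lemma ae_tendsto_zero_of_continuousOn {W B : ℝ≥0 → Ω → ℝ} (hW : IsBrownianReal W P)
    (hB : IsPreBrownianReal B P) (hc : ∀ᵐ ω ∂P, ContinuousOn (fun t ↦ B t ω) (Ioi 0)) :
    ∀ᵐ ω ∂P, Tendsto (fun t ↦ B t ω) (𝓝[>] 0) (𝓝 0) := by
  have := hW.isGaussianProcess.isProbabilityMeasure
  obtain ⟨D, hDc, hDd⟩ := TopologicalSpace.exists_countable_dense ℝ≥0
  have : Countable D := hDc.to_subtype
  -- Restricted to a countable dense set of times, convergence at `0` is a measurable event of `D →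
  -- ℝ`. Its probability depends only on the finite-dimensional laws, so it transfers from `W` to
  -- `B`.
  let l : Filter D := comap Subtype.val (𝓝[>] 0)
  have hE : MeasurableSet {f : D → ℝ | Tendsto f l (𝓝 0)} :=
    measurableSet_tendsto _ (fun i ↦ measurable_pi_apply i)
  have hWm : AEMeasurable (fun ω (d : D) ↦ W d ω) P :=
    aemeasurable_pi_lambda _ fun d ↦ hW.aemeasurable d
  have hBm : AEMeasurable (fun ω (d : D) ↦ B d ω) P :=
    aemeasurable_pi_lambda _ fun d ↦ hB.aemeasurable d
  have hlaw : P.map (fun ω (d : D) ↦ W d ω) = P.map (fun ω (d : D) ↦ B d ω) := by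
    rw [map_eq_iff_forall_finset_map_restrict_eq (X := fun (d : D) ω ↦ W d ω)
      (Y := fun (d : D) ω ↦ B d ω) hWm hBm]
    intro I
    classical
    let J : Finset ℝ≥0 := I.image Subtype.val
    let φ : (J → ℝ) → (I → ℝ) := fun x i ↦ x ⟨i.1.1, Finset.mem_image_of_mem _ i.2⟩
    have hφ : Measurable φ := by fun_prop
    have key : ∀ {X : ℝ≥0 → Ω → ℝ}, IsPreBrownianReal X P →
        P.map (fun ω ↦ I.restrict fun d : D ↦ X d ω)
          = (BrownianReal.projectiveFamily J).map φ := fun {X} hX ↦ by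
      rw [← (hX.hasLaw J).map_eq, AEMeasurable.map_map_of_aemeasurable hφ.aemeasurable
        (hX.hasLaw J).aemeasurable]
      rfl
    rw [key hW.toIsPreBrownianReal, key hB]
  have hWE : ∀ᵐ ω ∂P, Tendsto (fun d : D ↦ W d ω) l (𝓝 0) := by
    filter_upwards [hW.tendsto_nhds_zero] with ω hω
    exact (hω.mono_left nhdsWithin_le_nhds).comp tendsto_comap
  have hBE : ∀ᵐ ω ∂P, Tendsto (fun d : D ↦ B d ω) l (𝓝 0) := by
    have h1 : ∀ᵐ f ∂(P.map (fun ω (d : D) ↦ W d ω)), Tendsto f l (𝓝 0) :=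
      (ae_map_iff hWm hE).2 hWE
    rw [hlaw] at h1
    exact (ae_map_iff hBm hE).1 h1
  filter_upwards [hBE, hc] with ω h1 h2
  rw [Metric.tendsto_nhds] at h1 ⊢
  intro ε hε
  have h3 := h1 (ε / 2) (by positivity)
  rw [eventually_comap, eventually_nhdsWithin_iff, Metric.eventually_nhds_iff_ball] at h3
  obtain ⟨δ, hδ, hball⟩ := h3
  rw [eventually_nhdsWithin_iff, Metric.eventually_nhds_iff_ball]
  refine ⟨δ, hδ, fun t ht ht0 ↦ ?_⟩
  -- Continuity on `(0, ∞)` carries the bound from the dense times to all times; the closed bound `ε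
  -- / 2` survives the closure.
  have hopen : IsOpen (Metric.ball (0 : ℝ≥0) δ ∩ Ioi 0) := Metric.isOpen_ball.inter isOpen_Ioi
  have hcl : t ∈ closure (Metric.ball (0 : ℝ≥0) δ ∩ Ioi 0 ∩ D) := by
    have := hDd.open_subset_closure_inter hopen ⟨ht, ht0⟩
    exact this
  have hcont : ContinuousWithinAt (fun s ↦ dist (B s ω) 0) (Metric.ball (0 : ℝ≥0) δ ∩ Ioi 0 ∩ D)
      t := ((h2 t ht0).mono (fun s hs ↦ hs.1.2)).dist continuousWithinAt_const
  have : dist (B t ω) 0 ∈ closure (Iic (ε / 2)) := by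
    refine hcont.mem_closure hcl ?_
    intro s hs
    exact (hball s hs.1.1 hs.1.2 ⟨s, hs.2⟩ rfl).le
  rw [isClosed_Iic.closure_eq] at this
  exact lt_of_le_of_lt this (by linarith)

/-- The **strong law of large numbers** for Brownian motion. -/
lemma ae_tendsto_brownian_div_atTop {W : ℝ≥0 → Ω → ℝ} (hW : IsBrownianReal W P) :
    ∀ᵐ ω ∂P, Tendsto (fun t : ℝ≥0 ↦ W t ω / (t : ℝ)) atTop (𝓝 0) := by
  have hc : ∀ᵐ ω ∂P, ContinuousOn (fun t : ℝ≥0 ↦ (t : ℝ) * W (1 / t) ω) (Ioi 0) := by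
    filter_upwards [hW.cont] with ω hω
    refine NNReal.continuous_coe.continuousOn.mul (hω.comp_continuousOn ?_)
    exact continuousOn_const.div continuousOn_id fun t ht ↦ (ne_of_gt ht)
  filter_upwards [ae_tendsto_zero_of_continuousOn hW hW.toIsPreBrownianReal.inv hc] with ω hω
  have hinv : Tendsto (fun t : ℝ≥0 ↦ t⁻¹) atTop (𝓝[>] 0) := tendsto_inv_atTop_nhdsGT_zero
  refine (hω.comp hinv).congr fun t ↦ ?_
  simp [div_eq_inv_mul]

end ErgodicUtility

namespace ErgodicUtility

/-! ### Itô's formula for the wealth process -/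

/-- Itô's formula for a single path of Brownian motion with drift. -/
lemma tendsto_dyadic_ito_sum_drift {t : ℝ≥0} {w v : ℝ≥0 → ℝ} (hw : Continuous w)
    (hqv : ∀ m j : ℕ, Tendsto (fun n ↦ ∑ k ∈ Finset.range (j * 2 ^ (n - m)),
      (w (t * (k + 1 : ℕ) / 2 ^ n) - w (t * k / 2 ^ n)) ^ 2) atTop (𝓝 ((t : ℝ) * j / 2 ^ m)))
    {y a b : ℝ} (hv : ∀ s, v s = y + a * s + b * w s) {R : Set ℝ} (hR : IsOpen R) {x : ℝ → ℝ}
    (hx : ContDiffOn ℝ 2 x R) (hvR : ∀ s ≤ t, v s ∈ R) :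
    Tendsto (fun n ↦ ∑ k ∈ Finset.range (2 ^ n), b * deriv x (v (t * k / 2 ^ n)) *
      (w (t * (k + 1 : ℕ) / 2 ^ n) - w (t * k / 2 ^ n))) atTop
      (𝓝 (x (v t) - x (v 0) - ∫ s in (0 : ℝ)..t, (a * deriv x (v s.toNNReal) +
        1 / 2 * b ^ 2 * deriv (deriv x) (v s.toNNReal)))) := by
  have hvc : Continuous v := by
    rw [show v = fun s ↦ y + a * s + b * w s from funext hv]; fun_prop
  have hcast : ∀ n k : ℕ, ((t : ℝ) * k / 2 ^ n).toNNReal = t * k / 2 ^ n := fun n k ↦ by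
    rw [← Real.toNNReal_coe (r := t * k / 2 ^ n)]; push_cast; rfl
  have hVc : ContinuousOn (fun s : ℝ ↦ v s.toNNReal) (Icc 0 t) := by fun_prop
  have hVR : ∀ s ∈ Icc (0 : ℝ) t, v s.toNNReal ∈ R := fun s hs ↦
    hvR _ (Real.toNNReal_le_iff_le_coe.2 hs.2)
  have hd1 : ContDiffOn ℝ 1 (deriv x) R := hx.deriv_of_isOpen hR (by norm_num)
  have hx1 : ContinuousOn (fun s : ℝ ↦ deriv x (v s.toNNReal)) (Icc 0 t) :=
    hd1.continuousOn.comp hVc hVR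
  have hx2 : ContinuousOn (fun s : ℝ ↦ deriv (deriv x) (v s.toNNReal)) (Icc 0 t) :=
    (hd1.continuousOn_deriv_of_isOpen hR (by norm_num)).comp hVc hVR
  have hΔ : ∀ n k : ℕ, v (t * (k + 1 : ℕ) / 2 ^ n) - v (t * k / 2 ^ n)
      = a * (t / 2 ^ n) + b * (w (t * (k + 1 : ℕ) / 2 ^ n) - w (t * k / 2 ^ n)) := fun n k ↦ by
    rw [hv, hv]; push_cast; ring
  have hsmall : Tendsto (fun n : ℕ ↦ (t : ℝ) / 2 ^ n) atTop (𝓝 0) :=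
    tendsto_const_nhds.div_atTop (tendsto_pow_atTop_atTop_of_one_lt (by norm_num))
  have hqvU : ∀ m j : ℕ, j ≤ 2 ^ m → Tendsto (fun n ↦ ∑ k ∈ Finset.range (j * 2 ^ (n - m)),
      (v ((t : ℝ) * (k + 1 : ℕ) / 2 ^ n).toNNReal - v ((t : ℝ) * k / 2 ^ n).toNNReal) ^ 2) atTop
      (𝓝 (b ^ 2 * ((t : ℝ) * j / 2 ^ m))) := by
    intro m j _
    -- Expand `(a t/2ⁿ + b Δw)²`: the cross terms telescope and, like the squared drift terms, carry
    -- a factor `t / 2ⁿ` that tends to zero.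
    have h1 := (hqv m j).const_mul (b ^ 2)
    have h2 := hsmall.mul_const (2 * a * b * (w (t * j / 2 ^ m) - w 0))
    have h3 := hsmall.mul_const (a ^ 2 * (t * j / 2 ^ m))
    have h4 := (h1.add h2).add h3
    simp only [zero_mul, add_zero] at h4
    refine h4.congr' ?_
    filter_upwards [eventually_ge_atTop m] with n hn
    have hpow : (2 : ℝ) ^ m * 2 ^ (n - m) = 2 ^ n := by rw [← pow_add, Nat.add_sub_cancel' hn]
    have htel := Finset.sum_range_sub (fun k : ℕ ↦ w (t * k / 2 ^ n)) (j * 2 ^ (n - m))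
    have e1 : t * ((j * 2 ^ (n - m) : ℕ) : ℝ≥0) / 2 ^ n = t * j / 2 ^ m := by
      ext
      push_cast
      rw [← hpow]
      field_simp
    rw [e1, Nat.cast_zero, mul_zero, zero_div] at htel
    simp only [hcast, hΔ]
    rw [← htel, Finset.mul_sum, Finset.mul_sum, Finset.mul_sum, ← Finset.sum_add_distrib]
    have e2 : (t : ℝ) / 2 ^ n * (a ^ 2 * (t * j / 2 ^ m))
        = ∑ k ∈ Finset.range (j * 2 ^ (n - m)), (a * (t / 2 ^ n)) ^ 2 := by
      rw [Finset.sum_const, Finset.card_range, nsmul_eq_mul, ← hpow]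
      push_cast
      field_simp
    rw [e2, ← Finset.sum_add_distrib]
    exact Finset.sum_congr rfl fun k _ ↦ by ring
  have hito := tendsto_dyadic_ito_sum t.coe_nonneg hVc hR hVR hx hqvU
  have hrie := (tendsto_dyadic_riemann_sum t.coe_nonneg hx1).const_mul a
  have hlim := hito.sub hrie
  have hi1 : IntervalIntegrable (fun s : ℝ ↦ deriv x (v s.toNNReal)) volume 0 t :=
    ContinuousOn.intervalIntegrable (by rwa [uIcc_of_le t.coe_nonneg])
  have hi2 : IntervalIntegrable (fun s : ℝ ↦ deriv (deriv x) (v s.toNNReal)) volume 0 t :=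
    ContinuousOn.intervalIntegrable (by rwa [uIcc_of_le t.coe_nonneg])
  rw [intervalIntegral.integral_add (hi1.const_mul _) (hi2.const_mul _),
    intervalIntegral.integral_const_mul, intervalIntegral.integral_const_mul]
  simp only [hcast, hΔ, Real.toNNReal_coe, Real.toNNReal_zero] at hlim
  convert hlim using 2
  · rw [Finset.mul_sum, ← Finset.sum_sub_distrib]
    exact Finset.sum_congr rfl fun k _ ↦ by ring
  · ring

/-! ### Dyadic step processes and the approximation of Itô integrals -/

variable {Ω : Type*} [mΩ : MeasurableSpace Ω] {P : Measure Ω}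

/-- The step process that samples an adapted process `V` on the `n`-th dyadic grid of `[0, t]`. -/
noncomputable def dyadicStep {𝓕 : Filtration ℝ≥0 mΩ} {V : ℝ≥0 → Ω → ℝ} (hV : ∀ s, Measurable[𝓕 s] (V s))
    (t : ℝ≥0) (n : ℕ) : StepProcess 𝓕 where
  n := 2 ^ n
  time k := t * k / 2 ^ n
  mono := fun k l hkl ↦ by dsimp only; gcongr
  coeff k := V (t * k / 2 ^ n)
  measurable_coeff k := hV _

lemma StepProcess.measurable_value {𝓕 : Filtration ℝ≥0 mΩ} (H : StepProcess 𝓕) :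
    Measurable fun p : ℝ≥0 × Ω ↦ H.value p.1 p.2 := by
  unfold StepProcess.value
  refine Finset.measurable_fun_sum _ fun i _ ↦ ?_
  have : (fun p : ℝ≥0 × Ω ↦ (Ioc (H.time i) (H.time (i + 1))).indicator
      (fun _ ↦ H.coeff i p.2) p.1)
      = (Prod.fst ⁻¹' Ioc (H.time i) (H.time (i + 1))).indicator (fun p ↦ H.coeff i p.2) := by
    ext p; simp [indicator]
  rw [this]
  exact (((H.measurable_coeff i).mono (𝓕.le _) le_rfl).comp measurable_snd).indicator
    (measurable_fst measurableSet_Ioc)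

section dyadicStep

variable {𝓕 : Filtration ℝ≥0 mΩ} {V : ℝ≥0 → Ω → ℝ} (hV : ∀ s, Measurable[𝓕 s] (V s))
  {t : ℝ≥0} {n : ℕ}

lemma dyadicStep_integral (W : ℝ≥0 → Ω → ℝ) (ω : Ω) :
    (dyadicStep hV t n).integral W t ω = ∑ k ∈ Finset.range (2 ^ n),
      V (t * k / 2 ^ n) ω * (W (t * (k + 1 : ℕ) / 2 ^ n) ω - W (t * k / 2 ^ n) ω) := by
  refine Finset.sum_congr rfl fun k hk ↦ ?_
  have hle : ∀ l : ℕ, l ≤ 2 ^ n → t * l / 2 ^ n ≤ t := fun l hl ↦ by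
    rw [div_le_iff₀ (by positivity)]
    have : (l : ℝ≥0) ≤ 2 ^ n := by exact_mod_cast hl
    gcongr
  have hk := Finset.mem_range.1 hk
  simp only [dyadicStep]
  rw [min_eq_left (hle _ hk.le), min_eq_left (hle (k + 1) hk)]

lemma dyadicStep_value {k : ℕ} (hk : k < 2 ^ n) {s : ℝ≥0}
    (hs : s ∈ Ioc (t * k / 2 ^ n) (t * (k + 1 : ℕ) / 2 ^ n)) (ω : Ω) :
    (dyadicStep hV t n).value s ω = V (t * k / 2 ^ n) ω := by
  refine (Finset.sum_eq_single_of_mem k (Finset.mem_range.2 hk) ?_).trans ?_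
  rotate_left
  · exact indicator_of_mem hs _
  · intro l _ hlk
    refine indicator_of_notMem (fun hl ↦ ?_) _
    have hm := (dyadicStep hV t n).mono
    rcases lt_or_gt_of_ne hlk with h | h
    · exact absurd (hl.2.trans (hm (Nat.succ_le_of_lt h))) (not_le.2 hs.1)
    · exact absurd (hs.2.trans (hm (Nat.succ_le_of_lt h))) (not_le.2 hl.1)

lemma exists_mem_dyadic_cell (n : ℕ) {s : ℝ≥0} (hs : s ∈ Ioc 0 t) :
    ∃ k : ℕ, k < 2 ^ n ∧ s ∈ Ioc (t * k / 2 ^ n) (t * (k + 1 : ℕ) / 2 ^ n) := by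
  have ht : 0 < t := hs.1.trans_le hs.2
  set r : ℝ≥0 := s * 2 ^ n / t with hr
  have hr0 : 0 < r := div_pos (mul_pos hs.1 (by positivity)) ht
  have hc0 : 0 < ⌈r⌉₊ := Nat.ceil_pos.2 hr0
  have hsr : s = t * r / 2 ^ n := by rw [hr]; field_simp
  have hrle : r ≤ (2 ^ n : ℕ) := by
    rw [hr, div_le_iff₀ ht, mul_comm]
    push_cast
    gcongr
    exact hs.2
  have h1 : ⌈r⌉₊ - 1 + 1 = ⌈r⌉₊ := Nat.sub_add_cancel hc0
  -- The cells are open on the left, so the index is the ceiling minus one rather than the floor.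
  refine ⟨⌈r⌉₊ - 1, ?_, ?_, ?_⟩
  · exact lt_of_lt_of_le (Nat.sub_lt hc0 one_pos) (Nat.ceil_le.2 hrle)
  · rw [hsr]
    have : ((⌈r⌉₊ - 1 : ℕ) : ℝ≥0) < r := Nat.lt_ceil.1 (by omega)
    exact div_lt_div_of_pos_right (mul_lt_mul_of_pos_left this ht) (by positivity)
  · rw [h1, hsr]
    gcongr
    exact Nat.le_ceil r

lemma tendsto_lintegral_dyadicStep {ω : Ω} (hc : ContinuousOn (fun s ↦ V s ω) (Iic t)) :
    Tendsto (fun n ↦ ∫⁻ s in Icc (0 : ℝ) t,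
      ENNReal.ofReal (((dyadicStep hV t n).value s.toNNReal ω - V s.toNNReal ω) ^ 2))
      atTop (𝓝 0) := by
  have hcomp : IsCompact (Iic t) := by
    rw [← Icc_bot]; exact isCompact_Icc
  have huc := hcomp.uniformContinuousOn_of_continuous hc
  refine ENNReal.tendsto_nhds_zero.2 fun η hη ↦ ?_
  obtain ⟨ε, hε, hεη⟩ : ∃ ε : ℝ, 0 < ε ∧ ENNReal.ofReal (ε ^ 2) * t ≤ η := by
    have : Tendsto (fun ε : ℝ ↦ ENNReal.ofReal (ε ^ 2) * t) (𝓝[>] 0) (𝓝 0) := by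
      have h1 : Tendsto (fun ε : ℝ ↦ ENNReal.ofReal (ε ^ 2)) (𝓝[>] 0) (𝓝 0) := by
        have h2 : Continuous fun ε : ℝ ↦ ENNReal.ofReal (ε ^ 2) :=
          ENNReal.continuous_ofReal.comp (continuous_pow 2)
        have := h2.tendsto 0
        simp only [ne_eq, OfNat.ofNat_ne_zero, not_false_eq_true, zero_pow,
          ENNReal.ofReal_zero] at this
        exact this.mono_left nhdsWithin_le_nhds
      simpa using ENNReal.Tendsto.mul_const h1 (Or.inr ENNReal.coe_ne_top)
    obtain ⟨ε, h1, h2⟩ := ((ENNReal.tendsto_nhds_zero.1 this η hη).and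
      self_mem_nhdsWithin).exists
    exact ⟨ε, h2, h1⟩
  obtain ⟨δ, hδ, hδε⟩ := Metric.uniformContinuousOn_iff_le.1 huc ε hε
  have hsmall : Tendsto (fun n : ℕ ↦ (t : ℝ) / 2 ^ n) atTop (𝓝 0) :=
    tendsto_const_nhds.div_atTop (tendsto_pow_atTop_atTop_of_one_lt (by norm_num))
  filter_upwards [hsmall.eventually (ge_mem_nhds hδ)] with n hn
  -- The time `0` lies in no cell, and the step process vanishes there; it is a null set.
  rw [setLIntegral_congr Ioc_ae_eq_Icc.symm]
  calc _ ≤ ∫⁻ s in Ioc (0 : ℝ) t, ENNReal.ofReal (ε ^ 2) := by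
        refine setLIntegral_mono measurable_const fun s hs ↦ ENNReal.ofReal_le_ofReal ?_
        have hs' : s.toNNReal ∈ Ioc 0 t :=
          ⟨Real.toNNReal_pos.2 hs.1, Real.toNNReal_le_iff_le_coe.2 hs.2⟩
        obtain ⟨k, hk, hsk⟩ := exists_mem_dyadic_cell n hs'
        rw [dyadicStep_value hV hk hsk]
        have h1 : ((s.toNNReal : ℝ≥0) : ℝ) ≤ ((t * (k + 1 : ℕ) / 2 ^ n : ℝ≥0) : ℝ) :=
          NNReal.coe_le_coe.2 hsk.2
        have h2 : ((t * (k + 1 : ℕ) / 2 ^ n : ℝ≥0) : ℝ) = ((t * k / 2 ^ n : ℝ≥0) : ℝ)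
          + t / 2 ^ n := by push_cast; ring
        have h3 : ((t * k / 2 ^ n : ℝ≥0) : ℝ) < (s.toNNReal : ℝ≥0) := NNReal.coe_lt_coe.2 hsk.1
        have hd : dist (V (t * k / 2 ^ n) ω) (V s.toNNReal ω) ≤ ε := by
          refine hδε _ (hsk.1.le.trans hs'.2) _ hs'.2 ?_
          rw [NNReal.dist_eq, abs_sub_comm, abs_of_pos (sub_pos.2 h3)]
          linarith
        rw [Real.dist_eq, abs_le] at hd
        exact sq_le_sq' hd.1 hd.2
    _ = ENNReal.ofReal (ε ^ 2) * t := by simp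
    _ ≤ η := hεη

end dyadicStep

/-- Making all paths continuous gives joint measurability in time and `ω`. Changing paths on a null
set may destroy adaptedness, so this version only serves for measurability, beside the adapted
original. -/
lemma exists_continuous_modification [IsProbabilityMeasure P] {W : ℝ≥0 → Ω → ℝ}
    (hW : ∀ᵐ ω ∂P, Continuous fun t ↦ W t ω) (hm : ∀ t, Measurable (W t)) :
    ∃ W' : ℝ≥0 → Ω → ℝ, Measurable (Function.uncurry W') ∧ ∀ᵐ ω ∂P, ∀ t, W t ω = W' t ω := by
  obtain ⟨N, hN, hNm, hN0⟩ := exists_measurable_superset_of_null (ae_iff.1 hW)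
  refine ⟨fun t ↦ Nᶜ.indicator (W t), ?_, ?_⟩
  · refine measurable_uncurry_of_continuous_of_measurable (fun ω ↦ ?_)
      fun t ↦ (hm t).indicator hNm.compl
    by_cases hω : ω ∈ N
    · simpa [hω] using continuous_const
    · have : Continuous fun t ↦ W t ω := by
        by_contra h; exact hω (hN h)
      simpa [hω] using this
  · have : ∀ᵐ ω ∂P, ω ∉ N := by
      rw [ae_iff]; simpa using hN0
    filter_upwards [this] with ω hω t
    simp [hω]

/-- A pathwise criterion for Itô integrals: the sums along the dyadic grids converge almost surely
on `A`, where integrand and integral agree with measurable versions. -/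
lemma isItoIntegralOn_of_ae_tendsto [IsProbabilityMeasure P] {𝓕 : Filtration ℝ≥0 mΩ}
    {W : ℝ≥0 → Ω → ℝ} (hW : ∀ s, Measurable (W s)) {A : Set Ω} {t : ℝ≥0} {V V' H : ℝ≥0 → Ω → ℝ}
    {I I' : Ω → ℝ} (hV : ∀ s, Measurable[𝓕 s] (V s)) (hV' : Measurable (Function.uncurry V'))
    (hI' : Measurable I') (hHV : ∀ ω ∈ A, ∀ s ≤ t, H s ω = V s ω)
    (hVV' : ∀ᵐ ω ∂P, ω ∈ A → ∀ s ≤ t, V s ω = V' s ω) (hII' : ∀ᵐ ω ∂P, ω ∈ A → I ω = I' ω)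
    (hVc : ∀ᵐ ω ∂P, ω ∈ A → ContinuousOn (fun s ↦ V s ω) (Iic t))
    (hlim : ∀ᵐ ω ∂P, ω ∈ A → Tendsto (fun n ↦ ∑ k ∈ Finset.range (2 ^ n), V (t * k / 2 ^ n) ω *
      (W (t * (k + 1 : ℕ) / 2 ^ n) ω - W (t * k / 2 ^ n) ω)) atTop (𝓝 (I ω))) :
    IsItoIntegralOn 𝓕 W P A H t I := by
  have hst : ∀ s ∈ Icc (0 : ℝ) t, s.toNNReal ≤ t := fun s hs ↦ Real.toNNReal_le_iff_le_coe.2 hs.2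
  have hmeas : Measurable fun p : Ω × ℝ ↦ (p.2.toNNReal, p.1) :=
    (measurable_real_toNNReal.comp measurable_snd).prodMk measurable_fst
  refine ⟨dyadicStep hV t, fun ε hε ↦ ?_, fun ε hε ↦ ?_⟩
  · refine tendsto_measure_of_ae_tendsto_zero_on (f := fun n ω ↦ ∫⁻ s in Icc (0 : ℝ) t,
      ENNReal.ofReal (((dyadicStep hV t n).value s.toNNReal ω - H s.toNNReal ω) ^ 2))
      (g := fun n ω ↦ ∫⁻ s in Icc (0 : ℝ) t,
      ENNReal.ofReal (((dyadicStep hV t n).value s.toNNReal ω - V' s.toNNReal ω) ^ 2))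
      (fun n ↦ ?_) ?_ ?_ hε
    · have h1 : Measurable fun p : Ω × ℝ ↦ (dyadicStep hV t n).value p.2.toNNReal p.1 :=
        (dyadicStep hV t n).measurable_value.comp hmeas
      have h2 : Measurable fun p : Ω × ℝ ↦ V' p.2.toNNReal p.1 := hV'.comp hmeas
      have h3 := ((h1.sub h2).pow_const 2).ennreal_ofReal
      exact h3.lintegral_prod_right'
    · filter_upwards [hVV'] with ω hω hA n
      refine setLIntegral_congr_fun measurableSet_Icc fun s hs ↦ ?_
      rw [hHV ω hA _ (hst s hs), hω hA _ (hst s hs)]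
    · filter_upwards [hVc] with ω hω hA
      refine (tendsto_lintegral_dyadicStep hV (hω hA)).congr fun n ↦ ?_
      refine setLIntegral_congr_fun measurableSet_Icc fun s hs ↦ ?_
      rw [hHV ω hA _ (hst s hs)]
  · have hset : ∀ n ω, ε ≤ |(dyadicStep hV t n).integral W t ω - I ω| ↔
        ENNReal.ofReal ε ≤ ENNReal.ofReal |(dyadicStep hV t n).integral W t ω - I ω| :=
      fun n ω ↦ (ENNReal.ofReal_le_ofReal_iff (abs_nonneg _)).symm
    simp only [hset]
    refine tendsto_measure_of_ae_tendsto_zero_on (f := fun n ω ↦ ENNReal.ofReal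
      |(dyadicStep hV t n).integral W t ω - I ω|) (g := fun n ω ↦ ENNReal.ofReal
      |(dyadicStep hV t n).integral W t ω - I' ω|) (fun n ↦ ?_) ?_ ?_ (ENNReal.ofReal_pos.2 hε)
    · have h1 : Measurable fun ω ↦ (dyadicStep hV t n).integral W t ω := by
        simp only [dyadicStep_integral]
        exact Finset.measurable_fun_sum _ fun k _ ↦
          ((hV _).mono (𝓕.le _) le_rfl).mul ((hW _).sub (hW _))
      exact (h1.sub hI').abs.ennreal_ofReal
    · filter_upwards [hII'] with ω hω hA n
      rw [hω hA]
    · filter_upwards [hlim] with ω hω hA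
      have h0 := ((hω hA).sub_const (I ω)).abs
      rw [sub_self, abs_zero] at h0
      have h3 := ENNReal.tendsto_ofReal h0
      rw [ENNReal.ofReal_zero] at h3
      refine h3.congr fun n ↦ ?_
      rw [dyadicStep_integral]

/-! ### The stochastic differential equation of wealth -/

variable {u : ℝ → ℝ} {D : Set ℝ}

lemma invFunOn_mem_and_eq {y : ℝ} (hy : y ∈ u '' D) :
    Function.invFunOn u D y ∈ D ∧ u (Function.invFunOn u D y) = y :=
  ⟨Function.invFunOn_mem hy, Function.invFunOn_eq hy⟩

lemma IsInvertibleUtility.measurable_invFunOn (hu : IsInvertibleUtility u D) :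
    Measurable (Function.invFunOn u D) := by
  refine measurable_of_restrict_of_restrict_compl hu.isOpen_range.measurableSet
    hu.contDiffOn_inv.continuousOn.domRestrict.measurable ?_
  -- Off the image, `invFunOn` takes one fixed default value.
  have : (u '' D)ᶜ.domRestrict (Function.invFunOn u D) = fun _ ↦ Classical.choice ⟨(0 : ℝ)⟩ := by
    ext y
    exact Function.invFunOn_neg y.2
  rw [this]
  exact measurable_const

lemma solvesSDE_wealth [IsProbabilityMeasure P] (hu : IsInvertibleUtility u D)
    {𝓕 : Filtration ℝ≥0 mΩ} {W : ℝ≥0 → Ω → ℝ} (hW : IsFilteredBrownian 𝓕 W P) (a b : ℝ)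
    {U₀ : Ω → ℝ} (hU₀ : Measurable[𝓕 0] U₀) {U : ℝ≥0 → Ω → ℝ} (hU : U = driftedBM a b U₀ W) :
    SolvesSDE 𝓕 W P (alive u D U) (wealthDrift u D a b) (wealthNoise u D b) (wealth u D U) := by
  set x := Function.invFunOn u D with hxdef
  have hR := hu.isOpen_range
  have hx : ContDiffOn ℝ 2 x (u '' D) := hu.contDiffOn_inv
  have hxm : Measurable x := hu.measurable_invFunOn
  have hUv : ∀ t ω, U t ω = U₀ ω + a * t + b * W t ω := fun t ω ↦ by rw [hU]; rfl
  have hUad : ∀ t, Measurable[𝓕 t] (U t) := fun t ↦ by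
    have h1 : Measurable[𝓕 t] U₀ := hU₀.mono (𝓕.mono zero_le) le_rfl
    have h2 : Measurable[𝓕 t] (W t) := (hW.adapted t).measurable
    rw [funext (hUv t)]
    exact (h1.add_const _).add (h2.const_mul b)
  have hd1 : ContDiffOn ℝ 1 (deriv x) (u '' D) := hx.deriv_of_isOpen hR (by norm_num)
  have hd2 := hd1.continuousOn_deriv_of_isOpen hR (by norm_num)
  have hux : ∀ t ω, ω ∈ alive u D U t → ∀ s ≤ t, u (wealth u D U s ω) = U s ω := fun t ω hω s hs ↦
    (invFunOn_mem_and_eq (hω s hs)).2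
  have hUc : ∀ᵐ ω ∂P, Continuous fun t ↦ U t ω := by
    filter_upwards [hW.isBrownian.cont] with ω hω
    simp only [hUv]
    fun_prop
  have hdrift : ∀ t ω, ω ∈ alive u D U t → ∀ s ∈ Icc (0 : ℝ) t,
      wealthDrift u D a b (wealth u D U s.toNNReal ω)
        = a * deriv x (U s.toNNReal ω) + 1 / 2 * b ^ 2 * deriv (deriv x) (U s.toNNReal ω) :=
    fun t ω hω s hs ↦ by
      rw [wealthDrift, hux t ω hω _ (Real.toNNReal_le_iff_le_coe.2 hs.2)]
  refine ⟨fun t ↦ (hxm.comp (hUad t)).stronglyMeasurable, ?_, ?_, ?_⟩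
  · filter_upwards [hUc] with ω hω t ht
    exact hx.continuousOn.comp hω.continuousOn fun s hs ↦ ht s hs
  · filter_upwards [hUc] with ω hω t ht
    refine ContinuousOn.intervalIntegrable ?_
    rw [uIcc_of_le t.coe_nonneg]
    refine ContinuousOn.congr (f := fun s : ℝ ↦ a * deriv x (U s.toNNReal ω) +
      1 / 2 * b ^ 2 * deriv (deriv x) (U s.toNNReal ω)) ?_ fun s hs ↦ hdrift t ω ht s hs
    have hV : ContinuousOn (fun s : ℝ ↦ U s.toNNReal ω) (Icc 0 t) :=
      (hω.comp continuous_real_toNNReal).continuousOn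
    have hVR : ∀ s ∈ Icc (0 : ℝ) t, U s.toNNReal ω ∈ u '' D := fun s hs ↦
      ht _ (Real.toNNReal_le_iff_le_coe.2 hs.2)
    exact (continuousOn_const.mul (hd1.continuousOn.comp hV hVR)).add
      (continuousOn_const.mul (hd2.comp hV hVR))
  -- The integral is defined as what the equation requires; the content is that it is the Itô
  -- integral of the noise coefficient.
  refine ⟨fun t ω ↦ wealth u D U t ω - wealth u D U 0 ω -
    ∫ s in (0 : ℝ)..t, wealthDrift u D a b (wealth u D U s.toNNReal ω), fun t ↦ ?_,
    ae_of_all _ fun ω t _ ↦ by ring⟩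
  have hWm : ∀ s, Measurable (W s) := fun s ↦ (hW.adapted s).measurable.mono (𝓕.le s) le_rfl
  obtain ⟨W', hW'm, hWW'⟩ := exists_continuous_modification hW.isBrownian.cont hWm
  have hU₀m : Measurable U₀ := hU₀.mono (𝓕.le 0) le_rfl
  have hUm : ∀ s, Measurable (U s) := fun s ↦ (hUad s).mono (𝓕.le s) le_rfl
  set U' : ℝ≥0 → Ω → ℝ := fun s ω ↦ U₀ ω + a * s + b * W' s ω
  have hU'm : Measurable fun p : ℝ≥0 × Ω ↦ U' p.1 p.2 := by
    have h1 : Measurable fun p : ℝ≥0 × Ω ↦ W' p.1 p.2 := hW'm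
    exact ((hU₀m.comp measurable_snd).add (by fun_prop)).add (h1.const_mul b)
  have hU'm' : Measurable fun p : Ω × ℝ ↦ U' p.2.toNNReal p.1 :=
    hU'm.comp ((measurable_real_toNNReal.comp measurable_snd).prodMk measurable_fst)
  have hUU' : ∀ᵐ ω ∂P, ∀ s, U s ω = U' s ω := by
    filter_upwards [hWW'] with ω hω s
    rw [hUv, hω]
  have hV : ∀ s, Measurable[𝓕 s] fun ω ↦ b * deriv x (U s ω) := fun s ↦
    ((measurable_deriv x).comp (hUad s)).const_mul b
  have hIeq : ∀ ω, ω ∈ alive u D U t →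
      ∫ s in (0 : ℝ)..t, wealthDrift u D a b (wealth u D U s.toNNReal ω)
      = ∫ s in (0 : ℝ)..t, (a * deriv x (U s.toNNReal ω) +
        1 / 2 * b ^ 2 * deriv (deriv x) (U s.toNNReal ω)) := fun ω hω ↦
    intervalIntegral.integral_congr fun s hs ↦ by
      rw [uIcc_of_le t.coe_nonneg] at hs
      exact hdrift t ω hω s hs
  refine isItoIntegralOn_of_ae_tendsto hWm hV (V' := fun s ω ↦ b * deriv x (U' s ω))
    (I' := fun ω ↦ x (U t ω) - x (U 0 ω) - ∫ s in Ioc (0 : ℝ) t, (a * deriv x (U' s.toNNReal ω) +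
      1 / 2 * b ^ 2 * deriv (deriv x) (U' s.toNNReal ω)))
    (((measurable_deriv x).comp hU'm).const_mul b) ?_ (fun ω hA s hs ↦ ?_) ?_ ?_ ?_ ?_
  · have h2 : Measurable fun ω ↦ ∫ s in Ioc (0 : ℝ) t, (a * deriv x (U' s.toNNReal ω) +
        1 / 2 * b ^ 2 * deriv (deriv x) (U' s.toNNReal ω)) := by
      refine (StronglyMeasurable.integral_prod_right (f := fun ω (s : ℝ) ↦
        a * deriv x (U' s.toNNReal ω) + 1 / 2 * b ^ 2 * deriv (deriv x) (U' s.toNNReal ω))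
        ?_).measurable
      exact ((((measurable_deriv x).comp hU'm').const_mul a).add
        (((measurable_deriv (deriv x)).comp hU'm').const_mul (1 / 2 * b ^ 2))).stronglyMeasurable
    exact ((hxm.comp (hUm t)).sub (hxm.comp (hUm 0))).sub h2
  · rw [wealthNoise, hux t ω hA s hs]
  · filter_upwards [hUU'] with ω hω _ s _
    rw [hω]
  · filter_upwards [hUU'] with ω hω hA
    rw [hIeq ω hA, intervalIntegral.integral_of_le t.coe_nonneg]
    simp only [hω, wealth, ← hxdef]
  · filter_upwards [hUc] with ω hω hA
    exact continuousOn_const.mul (hd1.continuousOn.comp hω.continuousOn fun s hs ↦ hA s hs)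
  · have hqv : ∀ᵐ ω ∂P, ∀ m j : ℕ, Tendsto (fun n ↦ ∑ k ∈ Finset.range (j * 2 ^ (n - m)),
        (W (t * (k + 1 : ℕ) / 2 ^ n) ω - W (t * k / 2 ^ n) ω) ^ 2) atTop
        (𝓝 ((t : ℝ) * j / 2 ^ m)) :=
      ae_all_iff.2 fun m ↦ ae_all_iff.2 fun j ↦
        ae_tendsto_dyadic_quadratic_variation hW.isBrownian.toIsPreBrownianReal t m j
    filter_upwards [hqv, hW.isBrownian.cont] with ω h1 h2 hA
    have hlim := tendsto_dyadic_ito_sum_drift h2 h1 (v := fun s ↦ U s ω) (fun s ↦ hUv s ω)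
      hR hx (fun s hs ↦ hA s hs)
    rw [← hIeq ω hA] at hlim
    exact hlim

end ErgodicUtility

namespace ErgodicUtility

/-! ### Expected utility change, time-average growth and long-run preference -/

variable {Ω : Type*} [mΩ : MeasurableSpace Ω] {P : Measure Ω}

lemma ae_utilityChange_eq {u : ℝ → ℝ} {D : Set ℝ} {a b : ℝ} {U₀ : Ω → ℝ} {W U : ℝ≥0 → Ω → ℝ}
    (hU : U = driftedBM a b U₀ W) (h : ∀ᵐ ω ∂P, ∀ t, ω ∈ alive u D U t) :
    ∀ᵐ ω ∂P, ∀ t₀ Δt : ℝ≥0, utilityChange u (wealth u D U) t₀ Δt ω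
      = a * Δt + b * (W (t₀ + Δt) ω - W t₀ ω) := by
  filter_upwards [h] with ω hω t₀ Δt
  have hux : ∀ t, u (wealth u D U t ω) = U t ω := fun t ↦
    (invFunOn_mem_and_eq (hω t t le_rfl)).2
  rw [utilityChange, hux, hux, hU]
  simp only [driftedBM]
  push_cast
  ring

lemma integrable_utilityChange [IsProbabilityMeasure P] {Δu : Ω → ℝ} {a b : ℝ} {W : ℝ≥0 → Ω → ℝ}
    (hW : IsPreBrownianReal W P) (t₀ Δt : ℝ≥0)
    (h : ∀ᵐ ω ∂P, Δu ω = a * Δt + b * (W (t₀ + Δt) ω - W t₀ ω)) :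
    Integrable Δu P ∧ ∫ ω, Δu ω ∂P = a * Δt := by
  have hi : Integrable (fun ω ↦ b * (W (t₀ + Δt) ω - W t₀ ω)) P :=
    ((hW.integrable_eval _).sub (hW.integrable_eval _)).const_mul b
  refine ⟨((integrable_const (a * (Δt : ℝ))).add hi).congr (h.mono fun ω hω ↦ hω.symm), ?_⟩
  rw [integral_congr_ae h, integral_add (integrable_const _) hi, integral_const_mul b,
    integral_sub (hW.integrable_eval _) (hW.integrable_eval _), hW.integral_eval, hW.integral_eval]
  simp

lemma ae_tendsto_growth {a b : ℝ} {W : ℝ≥0 → Ω → ℝ} (hW : IsBrownianReal W P) (t₀ : ℝ≥0) :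
    ∀ᵐ ω ∂P, Tendsto (fun Δt : ℝ≥0 ↦ (a * Δt + b * (W (t₀ + Δt) ω - W t₀ ω)) / (Δt : ℝ)) atTop
      (𝓝 a) := by
  filter_upwards [ae_tendsto_brownian_div_atTop (hW.shift t₀)] with ω hω
  have h1 := (hω.const_mul b).const_add a
  rw [mul_zero, add_zero] at h1
  refine h1.congr' ?_
  filter_upwards [eventually_gt_atTop 0] with t ht
  have : (t : ℝ) ≠ 0 := by exact_mod_cast ht.ne'
  field_simp

/-- A centred Gaussian law is symmetric. Only an inequality holds, since the variable may be
degenerate. -/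
lemma measure_pos_le_half [IsProbabilityMeasure P] {Z : Ω → ℝ} (hZ : HasGaussianLaw Z P)
    (h0 : P[Z] = 0) : P.real {ω | 0 < Z ω} ≤ 1 / 2 := by
  have hmap := hZ.map_eq_gaussianReal
  rw [h0] at hmap
  set v := Var[Z; P].toNNReal
  have hlaw : HasLaw Z (gaussianReal 0 v) P := ⟨hZ.aemeasurable, hmap⟩
  rw [hlaw.measureReal_eq (p := fun z ↦ 0 < z) measurableSet_Ioi]
  have hsymm : (gaussianReal 0 v).real {z | z < 0} = (gaussianReal 0 v).real {z | 0 < z} := by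
    have h1 : (gaussianReal 0 v).map (fun z ↦ -z) = gaussianReal 0 v := by
      rw [gaussianReal_map_neg, neg_zero]
    conv_lhs => rw [← h1]
    rw [map_measureReal_apply (f := fun z : ℝ ↦ -z) (s := {z : ℝ | z < 0}) measurable_neg
      measurableSet_Iio]
    congr 1
    ext z
    simp
  have hdisj : Disjoint {z : ℝ | z < 0} {z : ℝ | 0 < z} :=
    Set.disjoint_left.2 fun z (h1 : z < 0) (h2 : 0 < z) ↦ lt_asymm h1 h2
  have hu := measureReal_union (μ := gaussianReal 0 v) hdisj measurableSet_Ioi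
  have hle := measureReal_le_one (μ := gaussianReal 0 v) (s := {z : ℝ | z < 0} ∪ {z : ℝ | 0 < z})
  linarith

/-- The noise that drives the difference of two alternatives. -/
lemma hasGaussianLaw_noise {ι : Type*} {W : ι → ℝ≥0 → Ω → ℝ}
    (hG : IsGaussianProcess (fun p : ι × ℝ≥0 ↦ W p.1 p.2) P) (i j : ι) (s t : ℝ≥0) (b c : ℝ) :
    HasGaussianLaw (fun ω ↦ b * (W i t ω - W i s ω) - c * (W j t ω - W j s ω)) P := by
  classical
  have hY : IsGaussianProcess (fun (_ : Unit) ω ↦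
      b * (W i t ω - W i s ω) - c * (W j t ω - W j s ω)) P := by
    refine hG.of_isGaussianProcess fun _ ↦ ⟨{(i, t), (i, s), (j, t), (j, s)},
      b • (ContinuousLinearMap.proj ⟨(i, t), by simp⟩ - ContinuousLinearMap.proj ⟨(i, s), by simp⟩)
      - c • (ContinuousLinearMap.proj ⟨(j, t), by simp⟩ -
        ContinuousLinearMap.proj ⟨(j, s), by simp⟩), fun ω ↦ ?_⟩
    simp
  exact hY.hasGaussianLaw_eval ()

end ErgodicUtility

/-! ### Utility changes, growth rates and long-run preference combined -/

open ErgodicUtility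
theorem mainTheorem1 {Ω : Type*} [mΩ : MeasurableSpace Ω] (P : Measure Ω) [IsProbabilityMeasure P]
    (u : ℝ → ℝ) (D : Set ℝ) (hu : ErgodicUtility.IsInvertibleUtility u D)
    -- a family of alternatives; the one with index `i` has utility `dU = a i dt + b i dW i`
    {ι : Type*} (𝓕 : ι → Filtration ℝ≥0 mΩ) (W : ι → ℝ≥0 → Ω → ℝ)
    (hW : ∀ i, ErgodicUtility.IsFilteredBrownian (𝓕 i) (W i) P)
    (a b : ι → ℝ) (U₀ : ι → Ω → ℝ) (hU₀ : ∀ i, Measurable[𝓕 i 0] (U₀ i))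
    (U X : ι → ℝ≥0 → Ω → ℝ)
    (hU : ∀ i, U i = ErgodicUtility.driftedBM (a i) (b i) (U₀ i) (W i))
    (hX : ∀ i, X i = ErgodicUtility.wealth u D (U i)) :
    -- while utility stays in the range of `u`, wealth `X i` has utility `U i` and follows the
    -- dynamic `dx = a_x(x) dt + b_x(x) dW` given by Itô's formula
    (∀ i,
      (∀ t, ∀ ω ∈ ErgodicUtility.alive u D (U i) t, X i t ω ∈ D ∧ u (X i t ω) = U i t ω) ∧
      ErgodicUtility.SolvesSDE (𝓕 i) (W i) P (ErgodicUtility.alive u D (U i))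
        (ErgodicUtility.wealthDrift u D (a i) (b i)) (ErgodicUtility.wealthNoise u D (b i))
        (X i)) ∧
    -- if utility never leaves the range of `u` (automatic if the range is `ℝ`), then
    ((∀ i, ∀ᵐ ω ∂P, ∀ t, ω ∈ ErgodicUtility.alive u D (U i) t) →
      -- the rate of change of expected utility is the time-average growth rate, namely `a i`
      (∀ i,
        (∀ t₀ Δt : ℝ≥0, 0 < Δt →
          Integrable (ErgodicUtility.utilityChange u (X i) t₀ Δt) P ∧
          (∫ ω, ErgodicUtility.utilityChange u (X i) t₀ Δt ω ∂P) / (Δt : ℝ) = a i) ∧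
        ErgodicUtility.IsTimeAverageGrowthRate u (X i) P (a i)) ∧
      -- maximising expected utility change is the same as maximising time-average growth
      (∀ r : ι → ℝ, (∀ i, ErgodicUtility.IsTimeAverageGrowthRate u (X i) P (r i)) →
        ∀ t₀ Δt : ℝ≥0, 0 < Δt → ∀ (S : Set ι), ∀ i ∈ S,
          (IsMaxOn (fun j ↦ ∫ ω, ErgodicUtility.utilityChange u (X j) t₀ Δt ω ∂P) S i ↔
            IsMaxOn r S i)) ∧
      -- and, pairwise, larger expected utility change means larger growth in the long run
      (∀ t₀ Δt : ℝ≥0, 0 < Δt → ∀ i j,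
        (∫ ω, ErgodicUtility.utilityChange u (X j) t₀ Δt ω ∂P) <
            ∫ ω, ErgodicUtility.utilityChange u (X i) t₀ Δt ω ∂P →
          Tendsto (fun T : ℝ≥0 ↦ P.real (ErgodicUtility.outgrows u (X i) (X j) t₀ T))
            atTop (𝓝 1)) ∧
      -- with equivalence if the driving noises are jointly Gaussian (for example all equal, or
      -- independent of each other)
      (IsGaussianProcess (fun p : ι × ℝ≥0 ↦ W p.1 p.2) P →
        ∀ t₀ Δt : ℝ≥0, 0 < Δt → ∀ i j,
          (ErgodicUtility.LongRunPrefers u (X i) (X j) P t₀ ↔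
            (∫ ω, ErgodicUtility.utilityChange u (X j) t₀ Δt ω ∂P) <
              ∫ ω, ErgodicUtility.utilityChange u (X i) t₀ Δt ω ∂P))) := by
  obtain rfl : X = fun i ↦ wealth u D (U i) := funext hX
  refine ⟨fun i ↦ ⟨fun t ω hω ↦ invFunOn_mem_and_eq (hω t le_rfl),
    solvesSDE_wealth hu (hW i) (a i) (b i) (hU₀ i) (hU i)⟩, fun hal ↦ ?_⟩
  have hB := fun i ↦ (hW i).isBrownian
  have hch := fun i ↦ ae_utilityChange_eq (hU i) (hal i)
  have h_int := fun i (t₀ Δt : ℝ≥0) ↦ integrable_utilityChange (hB i).toIsPreBrownianReal t₀ Δt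
    ((hch i).mono fun ω h ↦ h t₀ Δt)
  have hrate : ∀ i, IsTimeAverageGrowthRate u (wealth u D (U i)) P (a i) := fun i t₀ ↦ by
    filter_upwards [hch i, ae_tendsto_growth (a := a i) (b := b i) (hB i) t₀] with ω h1 h2
    simpa only [h1] using h2
  have hlt : ∀ t₀ Δt : ℝ≥0, 0 < Δt → ∀ i j,
      ((∫ ω, utilityChange u (wealth u D (U j)) t₀ Δt ω ∂P) <
        ∫ ω, utilityChange u (wealth u D (U i)) t₀ Δt ω ∂P) ↔ a j < a i := fun t₀ Δt hΔ i j ↦ by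
    rw [(h_int i t₀ Δt).2, (h_int j t₀ Δt).2]
    exact mul_lt_mul_iff_left₀ (by exact_mod_cast hΔ)
  have hWm : ∀ i s, Measurable (W i s) := fun i s ↦
    ((hW i).adapted s).measurable.mono ((𝓕 i).le s) le_rfl
  have hout : ∀ t₀ i j, a j < a i → Tendsto (fun T : ℝ≥0 ↦
      P.real (outgrows u (wealth u D (U i)) (wealth u D (U j)) t₀ T)) atTop (𝓝 1) := by
    intro t₀ i j hij
    -- No measurability of `u` is assumed, so `outgrows` is replaced by an almost surely equal event
    -- expressed through `W`.
    have hm : ∀ T : ℝ≥0, MeasurableSet {ω |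
        (a j * T + b j * (W j (t₀ + T) ω - W j t₀ ω)) / (T : ℝ)
          < (a i * T + b i * (W i (t₀ + T) ω - W i t₀ ω)) / (T : ℝ)} := fun T ↦ by
      have := hWm i (t₀ + T)
      have := hWm j (t₀ + T)
      have := hWm i t₀
      have := hWm j t₀
      exact measurableSet_lt (by fun_prop) (by fun_prop)
    have hlim := tendsto_measure_of_ae_tendsto_indicator_of_isFiniteMeasure (μ := P) atTop
      MeasurableSet.univ hm (by
        filter_upwards [ae_tendsto_growth (a := a i) (b := b i) (hB i) t₀,
          ae_tendsto_growth (a := a j) (b := b j) (hB j) t₀] with ω h1 h2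
        filter_upwards [h2.eventually_lt h1 hij] with T hT
        simpa using hT)
    have hlim' := (ENNReal.tendsto_toReal (measure_ne_top P univ)).comp hlim
    rw [measure_univ, ENNReal.toReal_one] at hlim'
    refine hlim'.congr fun T ↦ measureReal_congr ?_
    filter_upwards [hch i, hch j] with ω h1 h2
    simp only [outgrows, eq_iff_iff]
    change _ < _ ↔ _ < _
    rw [h1, h2]
  refine ⟨fun i ↦ ⟨fun t₀ Δt hΔ ↦ ⟨(h_int i t₀ Δt).1, ?_⟩, hrate i⟩, fun r hr t₀ Δt hΔ S i hi ↦ ?_,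
    fun t₀ Δt hΔ i j h ↦ hout t₀ i j ((hlt t₀ Δt hΔ i j).1 h), fun hG t₀ Δt hΔ i j ↦ ?_⟩
  · rw [(h_int i t₀ Δt).2]
    exact mul_div_cancel_right₀ _ (by exact_mod_cast hΔ.ne')
  · have hra : r = a := funext fun j ↦ by
      obtain ⟨ω, h1, h2⟩ := ((hr j 0).and (hrate j 0)).exists
      exact tendsto_nhds_unique h1 h2
    have hΔ' : (0 : ℝ) < Δt := by exact_mod_cast hΔ
    simp only [hra, isMaxOn_iff, (h_int _ t₀ Δt).2, mul_le_mul_iff_left₀ hΔ']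
  · rw [hlt t₀ Δt hΔ i j]
    refine ⟨fun h ↦ ?_, fun h ε hε hε1 ↦ ?_⟩
    · by_contra! hle
      -- With `ε = 1 / 2` the criterion gives a probability above one half, contradicting the
      -- symmetry of the noise.
      obtain ⟨T, hT, hprob⟩ := h (1 / 2) (by norm_num) (by norm_num)
      have hZ := hasGaussianLaw_noise hG i j t₀ (t₀ + T) (b i) (b j)
      have hi : ∀ k, Integrable (fun ω ↦ b k * (W k (t₀ + T) ω - W k t₀ ω)) P := fun k ↦
        (((hB k).integrable_eval _).sub ((hB k).integrable_eval _)).const_mul _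
      have h0 : ∫ ω, b i * (W i (t₀ + T) ω - W i t₀ ω) - b j * (W j (t₀ + T) ω - W j t₀ ω) ∂P
          = 0 := by
        rw [integral_sub (hi i) (hi j), integral_const_mul, integral_const_mul,
          integral_sub ((hB i).integrable_eval _) ((hB i).integrable_eval _),
          integral_sub ((hB j).integrable_eval _) ((hB j).integrable_eval _)]
        simp [(hB _).integral_eval]
      have hhalf := measure_pos_le_half hZ h0
      have hsub : P.real (outgrows u (wealth u D (U i)) (wealth u D (U j)) t₀ T)
          ≤ P.real {ω | 0 < b i * (W i (t₀ + T) ω - W i t₀ ω)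
            - b j * (W j (t₀ + T) ω - W j t₀ ω)} := by
        refine ENNReal.toReal_mono (measure_ne_top _ _) (measure_mono_ae ?_)
        filter_upwards [hch i, hch j] with ω h1 h2 h3
        have hT' : (0 : ℝ) < T := by exact_mod_cast hT
        change _ / _ < _ / _ at h3
        rw [h1, h2, div_lt_div_iff_of_pos_right hT'] at h3
        have := mul_le_mul_of_nonneg_right hle hT'.le
        change 0 < _
        linarith
      linarith
    · obtain ⟨T, h1, h2⟩ := (((hout t₀ i j h).eventually (lt_mem_nhds (by linarith : 1 - ε < 1))).and
        (eventually_gt_atTop 0)).exists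
      exact ⟨T, h2, h1⟩
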